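/- Call $\varphi:[1,\infty)\to[1,\infty)$ \emph{admissible} if $\varphi(1)=1$, $\log\varphi$ is concave, and $\varphi$ is differentiable with $\gamma/x\le\varphi'(x)/\varphi(x)\le\beta/x$ for all $x\ge1$ and some constants $\gamma,\beta>0$. Let $(\mathcal M,\mu)$ and $(\mathcal N,\nu)$ be measure spaces. For a measurable function $f$ on $\mathcal M$ (functions are identified when equal almost everywhere) let $f^*_\mu(t)=\inf\{y>0:\mu(\{|f|>y\})\le t\}$, $t>0$, be its decreasing rearrangement, and put $$\|f\|_{L^{p,1}(\mu)}=\int_0^\infty t^{\frac1p-1}f_\mu^*(t)\,dt,\qquad \|f\|_{L^{p,\infty}(\mu)}=\sup_{t>0}t^{\frac1p}f_\mu^*(t),$$ $$\|f\|_{L^{p,1}\varphi(\log L)(\mu)}=\int_0^\infty\varphi\Big(1+\log^+\frac1r\Big)f_\mu^*(r)\,\frac{dr}{r^{1-\frac1p}};$$ each space consists of the measurable $f$ for which the corresponding quantity is finite; similarly for $\nu$. An operator $T$ on a vector space of measurable functions is \emph{sublinear} if $|T(f+g)|\le|Tf|+|Tg|$ and $|T(cf)|=|c||Tf|$ almost everywhere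 for all $f,g$ in the space and all scalars $c$. \textbf{Corollary.} Let $\varphi$ be admissible, $1<p_0<p_1<\infty$, $C\ge0$ and $\nu(\mathcal N)<\infty$. Let $T$ be a sublinear operator, defined on the linear span $D$ of the spaces $L^{p,1}(\mu)$, $p_0<p\le p_1$, with values in the measurable functions on $\mathcal N$, such that for every $p_0<p\le p_1$ $$\|Tf\|_{L^{p,\infty}(\nu)}\le C\,\varphi\Big(\Big[\frac1{p_0}-\frac1p\Big]^{-1}\Big)\|f\|_{L^{p,1}(\mu)}\qquad(f\in L^{p,1}(\mu)).$$ Then $$T:L^{p_0,1}\varphi(\log L)(\mu)\to L^{p_0,\infty}(\nu)\quad\text{with norm}\quad\le K\,\frac{C}{p_0-1},$$ in the following sense. The inequality $\|Tf\|_{L^{p_0,\infty}(\nu)}\le K\frac{C}{p_0-1}\|f\|_{L^{p_0,1}\varphi(\log L)(\mu)}$ holds for all $f\in D\cap L^{p_0,1}\varphi(\log L)(\mu)$, and the restriction of $T$ to $D\cap L^{p_0,1}\varphi(\log L)(\mu)$ extends to a sublinear operator $S$ on all of $L^{p_0,1}\varphi(\log L)(\mu)$ that satisfies the same inequality for every $f$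 in that space. Moreover $|S|$ is unique: if $S'$ is another sublinear extension to $L^{p_0,1}\varphi(\log L)(\mu)$ such that $S'f_n\to0$ in $\nu$-measure whenever $\|f_n\|_{L^{p_0,1}\varphi(\log L)(\mu)}\to0$, then $|S'f|=|Sf|$ almost everywhere for every $f$. Here, given $1<P<p_1$ and $0\le V<\infty$, the constant $K>0$ can be chosen depending only on $\varphi,p_1,P,V$, uniformly for all $1<p_0\le P$, all $\mu$, all $\nu$ with $\nu(\mathcal N)\le V$, all $C$ and all $T$. (In particular $K$ stays bounded as $p_0\to1^+$ with $p_1$ fixed.) -/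

import Mathlib

open MeasureTheory Filter Topology
open scoped ENNReal NNReal

namespace Extrapolation

/-- Admissible functions. The values of `φ` outside `[1, ∞)` are irrelevant. -/
structure Admissible (φ : ℝ → ℝ) : Prop where
  one_le : ∀ x, 1 ≤ x → 1 ≤ φ x
  map_one : φ 1 = 1
  log_concave : ConcaveOn ℝ (Set.Ici 1) fun x => Real.log (φ x)
  /-- `φ` is differentiable on `[1, ∞)` (one-sidedly at `1`) and
  `γ / x ≤ φ'(x) / φ(x) ≤ β / x` there. -/
  log_deriv : ∃ γ β : ℝ, 0 < γ ∧ 0 < β ∧ ∀ x, 1 ≤ x → ∃ d : ℝ,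
    HasDerivWithinAt φ d (Set.Ici 1) x ∧ γ / x ≤ d / φ x ∧ d / φ x ≤ β / x

section Spaces

variable {α 𝕜 : Type*} [MeasurableSpace α] [RCLike 𝕜] {μ : Measure α}

/-- The distribution function `λ_f(y) = μ {x : |f x| > y}`. -/
noncomputable def distribution (f : α →ₘ[μ] 𝕜) (y : ℝ≥0∞) : ℝ≥0∞ :=
  μ {x | y < ‖f x‖ₑ}

/-- The decreasing rearrangement `f^*(t) = inf {y > 0 : λ_f(y) ≤ t}`, with value `∞` if no finite
`y` qualifies (the value `y = ∞` always qualifies). -/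
noncomputable def rearrangement (f : α →ₘ[μ] 𝕜) (t : ℝ) : ℝ≥0∞ :=
  sInf {y : ℝ≥0∞ | 0 < y ∧ distribution f y ≤ ENNReal.ofReal t}

/-- `‖f‖_{L^{p,1}} = ∫_0^∞ t^{1/p - 1} f^*(t) dt`. -/
noncomputable def lorentzOneNorm (p : ℝ) (f : α →ₘ[μ] 𝕜) : ℝ≥0∞ :=
  ∫⁻ t in Set.Ioi (0 : ℝ), ENNReal.ofReal (t ^ (1 / p - 1)) * rearrangement f t

/-- `‖f‖_{L^{p,∞}} = sup_{t > 0} t^{1/p} f^*(t)`. -/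
noncomputable def weakNorm (p : ℝ) (f : α →ₘ[μ] 𝕜) : ℝ≥0∞ :=
  ⨆ (t : ℝ) (_ : 0 < t), ENNReal.ofReal (t ^ (1 / p)) * rearrangement f t

/-- `‖f‖_{L^{p,1} φ(log L)} = ∫_0^∞ φ(1 + log⁺ (1/r)) f^*(r) r^{1/p - 1} dr`. -/
noncomputable def lorentzLogNorm (φ : ℝ → ℝ) (p : ℝ) (f : α →ₘ[μ] 𝕜) : ℝ≥0∞ :=
  ∫⁻ r in Set.Ioi (0 : ℝ),
    ENNReal.ofReal (φ (1 + Real.posLog (1 / r))) * rearrangement f r *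
      ENNReal.ofReal (r ^ (1 / p - 1))

variable (𝕜 μ)

/-- The space `L^{p,1}(μ)`. -/
def LorentzOne (p : ℝ) : Set (α →ₘ[μ] 𝕜) := {f | lorentzOneNorm p f < ∞}

/-- The space `L^{p,1} φ(log L)(μ)`. -/
def LorentzLog (φ : ℝ → ℝ) (p : ℝ) : Set (α →ₘ[μ] 𝕜) := {f | lorentzLogNorm φ p f < ∞}

/-- The linear span of all the spaces `L^{p,1}(μ)` with `p₀ < p ≤ p₁`. -/
def lorentzSpan (p₀ p₁ : ℝ) : Submodule 𝕜 (α →ₘ[μ] 𝕜) :=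
  Submodule.span 𝕜 (⋃ p ∈ Set.Ioc p₀ p₁, LorentzOne 𝕜 μ p)

end Spaces

section Operators

variable {α β 𝕜 : Type*} [MeasurableSpace α] [MeasurableSpace β] [RCLike 𝕜]
  {μ : Measure α} {ν : Measure β}

/-- `T` is a sublinear operator on `D` (a vector space of classes of measurable functions); the
values of `T` outside `D` are irrelevant. -/
structure SublinearOn (D : Set (α →ₘ[μ] 𝕜)) (T : (α →ₘ[μ] 𝕜) → (β →ₘ[ν] 𝕜)) : Prop where
  add_le : ∀ f ∈ D, ∀ g ∈ D, ∀ᵐ y ∂ν, ‖T (f + g) y‖ ≤ ‖T f y‖ + ‖T g y‖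
  smul_eq : ∀ (c : 𝕜), ∀ f ∈ D, ∀ᵐ y ∂ν, ‖T (c • f) y‖ = ‖c‖ * ‖T f y‖

/-- `T` maps null sequences of `L^{p,1} φ(log L)(μ)` to sequences that tend to `0` in measure. -/
def NullContinuous (φ : ℝ → ℝ) (p : ℝ) (T : (α →ₘ[μ] 𝕜) → (β →ₘ[ν] 𝕜)) : Prop :=
  ∀ u : ℕ → (α →ₘ[μ] 𝕜), Tendsto (fun n => lorentzLogNorm φ p (u n)) atTop (𝓝 0) →
    TendstoInMeasure ν (fun n => (T (u n) : β → 𝕜)) atTop (fun _ => 0)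

end Operators

end Extrapolation

/-! Cut `f` into layers on which `|f|` lies between consecutive dyadic levels `2 ^ k * c`. A layer
lives on a set of measure at most `s`, the distribution function of `f` at the lower level, and the
hypothesis may be used at an exponent chosen for that `s`. With `L = 1 + log⁺ (1/s)` and `1/p = 1/p₀
- δ/L`, where `δ = 1/P - 1/p₁`, passing from `s ^ (1/p₀)` to `s ^ (1/p)` costs at most a factor `e`,
while the operator constant is `φ (L/δ)`, at most a fixed multiple of `φ L` by polynomial growth
(`Admissible.exists_exponent`). Since `ν` is finite, the weak `L^p` bound gives a weak `L^{p₀}`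
bound, so each layer contributes its level times the mass of the logarithmic weight on `(0, s]`
(`weakNorm_cut_le`). Summing over the levels reproduces the `L^{p₀,1} φ(log L)` quantity up to a
factor (`sum_dyadic_setLIntegral_le`).

The weak quasi-norm cannot be summed over unboundedly many layers without loss. The layers are
therefore added through the integrals of `|T f|` over sets `E`, measured against `ν E ^ (1 - 1/p₀)`.
Passing to them costs `p₀ / (p₀ - 1)`, the only source of the singularity at `p₀ = 1`, and passing
back is free. The parts of `f` below the lowest and above the highest level vanish in the limit. For
the upper part this uses that `f` lies in the span, hence is locally in some `L^{q,1}` with `q >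
p₀`.

For the extension, sublinearity gives `| |T u| - |T v| | ≤ |T (u - v)|`, so the moduli along bounded
truncations of `f` are Cauchy in `L¹(ν)`. Their limit determines `|S f|`, and sublinearity, bounds
and uniqueness only involve moduli (`exists_sublinear_extension`). -/

namespace Extrapolation

/-! ### Rearrangements and their weighted integrals -/

section Rearrangement

variable {α 𝕜 : Type*} [MeasurableSpace α] [RCLike 𝕜] {μ : Measure α}

lemma distribution_antitone (f : α →ₘ[μ] 𝕜) : Antitone (distribution f) :=
  fun _ _ h => measure_mono fun _ hx => h.trans_lt hx

lemma distribution_mono {f g : α →ₘ[μ] 𝕜} (h : ∀ᵐ x ∂μ, ‖f x‖ₑ ≤ ‖g x‖ₑ) (y : ℝ≥0∞) :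
    distribution f y ≤ distribution g y :=
  measure_mono_ae (h.mono fun _ hx (hy : y < _) => (hy.trans_le hx : y < _))

lemma distribution_add_le (f g : α →ₘ[μ] 𝕜) (y z : ℝ≥0∞) :
    distribution (f + g) (y + z) ≤ distribution f y + distribution g z := by
  refine le_trans (measure_mono_ae ?_) (measure_union_le {x | y < ‖f x‖ₑ} {x | z < ‖g x‖ₑ})
  filter_upwards [AEEqFun.coeFn_add f g] with x hx (hy : y + z < ‖(f + g) x‖ₑ)
  change y < _ ∨ z < _
  by_contra! hcon
  rw [hx] at hy
  exact absurd ((enorm_add_le _ _).trans (add_le_add hcon.1 hcon.2)) hy.not_ge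

lemma rearrangement_antitone (f : α →ₘ[μ] 𝕜) : Antitone (rearrangement f) :=
  fun _ _ h => sInf_le_sInf fun _ hy => ⟨hy.1, hy.2.trans (ENNReal.ofReal_le_ofReal h)⟩

lemma rearrangement_mono {f g : α →ₘ[μ] 𝕜} (h : ∀ᵐ x ∂μ, ‖f x‖ₑ ≤ ‖g x‖ₑ) (t : ℝ) :
    rearrangement f t ≤ rearrangement g t :=
  sInf_le_sInf fun _ hy => ⟨hy.1, (distribution_mono h _).trans hy.2⟩

lemma rearrangement_le_of_forall {f : α →ₘ[μ] 𝕜} {t : ℝ} {b : ℝ≥0∞}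
    (h : ∀ y, b < y → distribution f y ≤ ENNReal.ofReal t) : rearrangement f t ≤ b :=
  le_of_forall_gt_imp_ge_of_dense fun y hy => sInf_le ⟨(zero_le).trans_lt hy, h y hy⟩

lemma le_rearrangement_of_lt {f : α →ₘ[μ] 𝕜} {t : ℝ} {y : ℝ≥0∞}
    (h : ENNReal.ofReal t < distribution f y) : y ≤ rearrangement f t :=
  le_sInf fun _ hz => le_of_lt <| by
    by_contra! hcon
    exact absurd ((distribution_antitone f hcon).trans hz.2) h.not_ge

lemma rearrangement_le_of_bound {f : α →ₘ[μ] 𝕜} {b : ℝ≥0∞} (h : ∀ᵐ x ∂μ, ‖f x‖ₑ ≤ b) (t : ℝ) :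
    rearrangement f t ≤ b := by
  refine rearrangement_le_of_forall fun y hy => ?_
  have : distribution f y = 0 := by
    refine measure_mono_null_ae ?_ (measure_empty (μ := μ))
    filter_upwards [h] with x hx (hxy : y < _)
    exact absurd (hxy.trans_le hx) hy.not_gt
  simp [this]

lemma rearrangement_eq_zero {f : α →ₘ[μ] 𝕜} {t : ℝ} (h : distribution f 0 ≤ ENNReal.ofReal t) :
    rearrangement f t = 0 :=
  le_antisymm (rearrangement_le_of_forall fun _ _ =>
    (distribution_antitone f (zero_le)).trans h) (zero_le)

lemma rearrangement_add_le (f g : α →ₘ[μ] 𝕜) {t : ℝ} (ht : 0 ≤ t) :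
    rearrangement (f + g) t ≤ rearrangement f (t / 2) + rearrangement g (t / 2) := by
  unfold rearrangement
  rw [ENNReal.sInf_add]
  refine le_iInf₂ fun y hy => ?_
  rw [ENNReal.add_sInf]
  refine le_iInf₂ fun z hz => sInf_le ⟨hy.1.trans_le le_self_add, ?_⟩
  refine (distribution_add_le f g y z).trans ((add_le_add hy.2 hz.2).trans_eq ?_)
  rw [← ENNReal.ofReal_add (by positivity) (by positivity), add_halves]

lemma rearrangement_smul_le (c : 𝕜) (f : α →ₘ[μ] 𝕜) (t : ℝ) :
    rearrangement (c • f) t ≤ ‖c‖ₑ * rearrangement f t := by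
  rcases eq_or_ne c 0 with rfl | hc
  · refine (rearrangement_le_of_bound (b := 0) ?_ t).trans (zero_le)
    filter_upwards [AEEqFun.coeFn_smul (0 : 𝕜) f] with x hx
    simp [hx]
  have h0 : ‖c‖ₑ ≠ 0 := by simpa using hc
  rw [mul_comm, ← ENNReal.div_le_iff_le_mul (.inl h0) (.inl enorm_ne_top)]
  refine le_sInf fun y hy => ?_
  rw [ENNReal.div_le_iff_le_mul (.inl h0) (.inl enorm_ne_top)]
  refine sInf_le ⟨ENNReal.mul_pos hy.1.ne' h0, le_trans (measure_mono_ae ?_) hy.2⟩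
  filter_upwards [AEEqFun.coeFn_smul c f] with x hx (hxy : _ < _)
  rw [hx, Pi.smul_apply, enorm_smul, mul_comm ‖c‖ₑ] at hxy
  exact lt_of_mul_lt_mul_right' hxy

/-- The integral of the decreasing rearrangement against a weight. -/
noncomputable def weightedNorm (w : ℝ → ℝ≥0∞) (f : α →ₘ[μ] 𝕜) : ℝ≥0∞ :=
  ∫⁻ t in Set.Ioi (0 : ℝ), w t * rearrangement f t

lemma weightedNorm_mono (w : ℝ → ℝ≥0∞) {f g : α →ₘ[μ] 𝕜} (h : ∀ᵐ x ∂μ, ‖f x‖ₑ ≤ ‖g x‖ₑ) :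
    weightedNorm w f ≤ weightedNorm w g :=
  lintegral_mono fun t => mul_le_mul_right (rearrangement_mono h t) _

lemma measurable_rearrangement (f : α →ₘ[μ] 𝕜) : Measurable (rearrangement f) :=
  (rearrangement_antitone f).measurable

lemma aemeasurable_weight {w : ℝ → ℝ≥0∞} (hw : AntitoneOn w (Set.Ioi 0)) :
    AEMeasurable w (volume.restrict (Set.Ioi 0)) :=
  aemeasurable_restrict_of_antitoneOn measurableSet_Ioi hw

/-- Substitute `t = 2 s` and use `w (2 s) ≤ w s`. This absorbs the `t / 2` of `rearrangement_add_le`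
and makes `weightedNorm` a quasi-norm with constant 2. -/
lemma lintegral_weight_mul_half_le {w : ℝ → ℝ≥0∞} (hw : AntitoneOn w (Set.Ioi 0))
    (f : ℝ → ℝ≥0∞) :
    ∫⁻ t in Set.Ioi (0 : ℝ), w t * f (t / 2) ≤ 2 * ∫⁻ t in Set.Ioi (0 : ℝ), w t * f t := by
  have himg : (fun t : ℝ => 2 * t) '' Set.Ioi 0 = Set.Ioi 0 := by
    ext x
    constructor
    · rintro ⟨t, ht, rfl⟩
      have : 0 < t := ht
      simpa using this
    · intro hx
      exact ⟨x / 2, half_pos (Set.mem_Ioi.1 hx), by ring⟩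
  rw [← lintegral_const_mul' _ _ (by simp)]
  conv_lhs => rw [← himg]
  rw [lintegral_image_eq_lintegral_abs_deriv_mul measurableSet_Ioi
    (f := fun t : ℝ => 2 * t) (f' := fun _ => 2)
    (fun x _ => by simpa using ((hasDerivAt_id x).const_mul (2 : ℝ)).hasDerivWithinAt)
    (fun x _ y _ h => by simpa using h)]
  refine setLIntegral_mono' measurableSet_Ioi fun t (ht : 0 < t) => ?_
  have h2 : ENNReal.ofReal |(2 : ℝ)| = 2 := by simp
  rw [h2, mul_div_cancel_left₀ t two_ne_zero]
  gcongr
  exact hw ht (by simpa using ht) (by linarith)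

lemma weightedNorm_add_le {w : ℝ → ℝ≥0∞} (hw : AntitoneOn w (Set.Ioi 0)) (f g : α →ₘ[μ] 𝕜) :
    weightedNorm w (f + g) ≤ 2 * (weightedNorm w f + weightedNorm w g) := by
  have hf := lintegral_weight_mul_half_le hw (rearrangement f)
  have hg := lintegral_weight_mul_half_le hw (rearrangement g)
  rw [mul_add]
  refine le_trans ?_ (add_le_add hf hg)
  have hm : AEMeasurable (fun t => w t * rearrangement f (t / 2))
      (volume.restrict (Set.Ioi 0)) :=
    (aemeasurable_weight hw).mul
      ((measurable_rearrangement f).comp (measurable_id.div_const 2)).aemeasurable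
  rw [← lintegral_add_left' hm]
  refine setLIntegral_mono' measurableSet_Ioi fun t (ht : 0 < t) => ?_
  rw [← mul_add]
  exact mul_le_mul_right (rearrangement_add_le f g ht.le) _

lemma weightedNorm_smul_le (w : ℝ → ℝ≥0∞) (c : 𝕜) (f : α →ₘ[μ] 𝕜) :
    weightedNorm w (c • f) ≤ ‖c‖ₑ * weightedNorm w f := by
  unfold weightedNorm
  rw [← lintegral_const_mul' _ _ enorm_ne_top]
  refine lintegral_mono fun t => ?_
  rw [mul_left_comm]
  exact mul_le_mul_right (rearrangement_smul_le c f t) _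

lemma weightedNorm_neg (w : ℝ → ℝ≥0∞) (f : α →ₘ[μ] 𝕜) :
    weightedNorm w (-f) = weightedNorm w f := by
  refine le_antisymm (weightedNorm_mono w ?_) (weightedNorm_mono w ?_) <;>
  · filter_upwards [AEEqFun.coeFn_neg f] with x hx
    simp [hx]

lemma weightedNorm_sub_le {w : ℝ → ℝ≥0∞} (hw : AntitoneOn w (Set.Ioi 0)) (f g : α →ₘ[μ] 𝕜) :
    weightedNorm w (f - g) ≤ 2 * (weightedNorm w f + weightedNorm w g) := by
  rw [sub_eq_add_neg, ← weightedNorm_neg w g]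
  exact weightedNorm_add_le hw f (-g)

/-- Dominated convergence for weighted integrals of rearrangements. -/
lemma tendsto_weightedNorm_zero {w : ℝ → ℝ≥0∞} (hw : AntitoneOn w (Set.Ioi 0))
    (hwt : ∀ t, 0 < t → w t ≠ ∞) (F : ℝ → ℝ≥0∞)
    (hF : ∫⁻ t in Set.Ioi (0 : ℝ), w t * F t ≠ ∞) {u : ℕ → (α →ₘ[μ] 𝕜)}
    (hu : ∀ᶠ n in atTop, ∀ t, 0 < t → rearrangement (u n) t ≤ F t)
    (h0 : ∀ t, 0 < t → Tendsto (fun n => rearrangement (u n) t) atTop (𝓝 0)) :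
    Tendsto (fun n => weightedNorm w (u n)) atTop (𝓝 0) := by
  have key : Tendsto (fun n => weightedNorm w (u n)) atTop
      (𝓝 (∫⁻ _ in Set.Ioi (0 : ℝ), 0)) := by
    refine tendsto_lintegral_filter_of_dominated_convergence' (fun t => w t * F t) ?_ ?_ hF ?_
    · exact .of_forall fun n =>
        (aemeasurable_weight hw).mul (measurable_rearrangement (u n)).aemeasurable
    · filter_upwards [hu] with n hn
      filter_upwards [ae_restrict_mem measurableSet_Ioi] with t ht
      exact mul_le_mul_right (hn t ht) _
    · filter_upwards [ae_restrict_mem measurableSet_Ioi] with t ht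
      simpa using ENNReal.Tendsto.const_mul (h0 t ht) (.inr (hwt t ht))
  simpa using key

/-- A finite integral against a nonvanishing weight forces finiteness at some `r < t`, and
monotonicity carries it to `t`. -/
lemma rearrangement_lt_top {w : ℝ → ℝ≥0∞} (hw : AntitoneOn w (Set.Ioi 0))
    (hw0 : ∀ t, 0 < t → w t ≠ 0) {f : α →ₘ[μ] 𝕜} (hf : weightedNorm w f ≠ ∞) {t : ℝ}
    (ht : 0 < t) : rearrangement f t < ∞ := by
  have h := ae_lt_top' ((aemeasurable_weight hw).mul
    (measurable_rearrangement f).aemeasurable) hf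
  rw [ae_restrict_iff' measurableSet_Ioi] at h
  have hpos : volume (Set.Ioo 0 t) ≠ 0 := by simp [ht]
  obtain ⟨r, hr, hr'⟩ : ∃ r ∈ Set.Ioo 0 t, w r * rearrangement f r < ∞ := by
    by_contra! hcon
    refine hpos (measure_mono_null (fun r hr => ?_) h)
    intro hcon'
    exact absurd (hcon' hr.1) (hcon r hr).not_gt
  refine (rearrangement_antitone f hr.2.le).trans_lt ?_
  by_contra hcon
  rw [not_lt, top_le_iff] at hcon
  simp [hcon, ENNReal.mul_top (hw0 r hr.1)] at hr'

lemma exists_distribution_le {f : α →ₘ[μ] 𝕜} {t : ℝ} (h : rearrangement f t < ∞) :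
    ∃ y : ℝ≥0∞, y < ∞ ∧ distribution f y ≤ ENNReal.ofReal t := by
  obtain ⟨y, hy, hy'⟩ := sInf_lt_iff.1 h
  exact ⟨y, hy', hy.2⟩

end Rearrangement

/-! ### Truncation between two levels -/

section Cut

variable {α 𝕜 : Type*} [MeasurableSpace α] [RCLike 𝕜] {μ : Measure α}

lemma measurable_cutFun (a b : ℝ≥0∞) :
    Measurable fun z : 𝕜 => {z : 𝕜 | a < ‖z‖ₑ ∧ ‖z‖ₑ ≤ b}.indicator id z :=
  measurable_id.indicator
    ((measurableSet_lt measurable_const measurable_enorm).inter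
      (measurableSet_le measurable_enorm measurable_const))

/-- The part of `f` on which `a < |f| ≤ b`. -/
noncomputable def cut (a b : ℝ≥0∞) (f : α →ₘ[μ] 𝕜) : α →ₘ[μ] 𝕜 :=
  AEEqFun.compMeasurable _ (measurable_cutFun a b) f

lemma coeFn_cut (a b : ℝ≥0∞) (f : α →ₘ[μ] 𝕜) :
    ∀ᵐ x ∂μ, cut a b f x = {z : 𝕜 | a < ‖z‖ₑ ∧ ‖z‖ₑ ≤ b}.indicator id (f x) :=
  AEEqFun.coeFn_compMeasurable _ (measurable_cutFun a b) f

lemma cut_zero_top (f : α →ₘ[μ] 𝕜) : cut 0 ∞ f = f := by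
  refine AEEqFun.ext ?_
  filter_upwards [coeFn_cut 0 ∞ f] with x hx
  rw [hx]
  by_cases h : f x = 0
  · simp [h]
  · simp [Set.indicator, h, pos_iff_ne_zero]

lemma cut_add_cut {a b c : ℝ≥0∞} (hab : a ≤ b) (hbc : b ≤ c) (f : α →ₘ[μ] 𝕜) :
    cut a b f + cut b c f = cut a c f := by
  refine AEEqFun.ext ?_
  filter_upwards [coeFn_cut a b f, coeFn_cut b c f, coeFn_cut a c f,
    AEEqFun.coeFn_add (cut a b f) (cut b c f)] with x h1 h2 h3 h4
  rw [h4, Pi.add_apply, h1, h2, h3]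
  simp only [Set.indicator, Set.mem_ofPred_eq, id]
  rcases le_or_gt ‖f x‖ₑ b with h | h
  · simp [h, h.trans hbc, h.not_gt]
  · simp [h, hab.trans_lt h, h.not_ge]

lemma enorm_cut_le (a b : ℝ≥0∞) (f : α →ₘ[μ] 𝕜) : ∀ᵐ x ∂μ, ‖cut a b f x‖ₑ ≤ ‖f x‖ₑ := by
  filter_upwards [coeFn_cut a b f] with x hx
  rw [hx]
  exact enorm_indicator_le_enorm_self _ _

lemma enorm_cut_le_right (a b : ℝ≥0∞) (f : α →ₘ[μ] 𝕜) : ∀ᵐ x ∂μ, ‖cut a b f x‖ₑ ≤ b := by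
  filter_upwards [coeFn_cut a b f] with x hx
  rw [hx]
  by_cases h : f x ∈ {z : 𝕜 | a < ‖z‖ₑ ∧ ‖z‖ₑ ≤ b}
  · simpa [h] using h.2
  · simp [Set.indicator_of_notMem h]

lemma distribution_cut_zero_le (a b : ℝ≥0∞) (f : α →ₘ[μ] 𝕜) :
    distribution (cut a b f) 0 ≤ distribution f a := by
  refine measure_mono_ae ?_
  filter_upwards [coeFn_cut a b f] with x hx (h : 0 < _)
  rw [hx] at h
  by_contra hcon
  rw [Set.indicator_of_notMem (fun h' => hcon h'.1)] at h
  simp at h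

lemma rearrangement_cut_eq_zero {a : ℝ≥0∞} {f : α →ₘ[μ] 𝕜} {t : ℝ}
    (h : distribution f a ≤ ENNReal.ofReal t) (b : ℝ≥0∞) : rearrangement (cut a b f) t = 0 :=
  rearrangement_eq_zero ((distribution_cut_zero_le a b f).trans h)

/-- The parts of `f` above levels tending to infinity have rearrangements tending to `0`. -/
lemma tendsto_rearrangement_cut_top {f : α →ₘ[μ] 𝕜} {t : ℝ} (h : rearrangement f t < ∞)
    {a : ℕ → ℝ≥0∞} (ha : Tendsto a atTop (𝓝 ∞)) :
    Tendsto (fun n => rearrangement (cut (a n) ∞ f) t) atTop (𝓝 0) := by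
  obtain ⟨y, hy, hyt⟩ := exists_distribution_le h
  refine tendsto_const_nhds.congr' ?_
  filter_upwards [ha.eventually (lt_mem_nhds hy)] with n hn
  exact (rearrangement_cut_eq_zero ((distribution_antitone f hn.le).trans hyt) ∞).symm

lemma tendsto_weightedNorm_cut_top {w : ℝ → ℝ≥0∞} (hw : AntitoneOn w (Set.Ioi 0))
    (hwt : ∀ t, 0 < t → w t ≠ ∞) (hw0 : ∀ t, 0 < t → w t ≠ 0) {f : α →ₘ[μ] 𝕜}
    (hf : weightedNorm w f ≠ ∞) {a : ℕ → ℝ≥0∞} (ha : Tendsto a atTop (𝓝 ∞)) :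
    Tendsto (fun n => weightedNorm w (cut (a n) ∞ f)) atTop (𝓝 0) :=
  tendsto_weightedNorm_zero hw hwt (rearrangement f) hf
    (.of_forall fun _ _ _ => rearrangement_mono (enorm_cut_le _ _ f) _)
    fun _ ht => tendsto_rearrangement_cut_top (rearrangement_lt_top hw hw0 hf ht) ha

end Cut

/-! ### Weak Lebesgue spaces over a finite measure -/

section Target

variable {β 𝕜 : Type*} [MeasurableSpace β] [RCLike 𝕜] {ν : Measure β}

lemma distribution_le_of_weakNorm_le {p a y : ℝ} (hp : 0 < p) (ha : 0 ≤ a) (hy : 0 < y)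
    {h : β →ₘ[ν] 𝕜} (hA : weakNorm p h ≤ ENNReal.ofReal a) :
    distribution h (ENNReal.ofReal y) ≤ ENNReal.ofReal ((a / y) ^ p) := by
  by_contra! hcon
  obtain ⟨t, ht, ht'⟩ := ENNReal.lt_iff_exists_nnreal_btwn.1 hcon
  have hay : 0 ≤ a / y := by positivity
  have h1 : (a / y) ^ p < t := by
    rwa [← ENNReal.ofReal_coe_nnreal, ENNReal.ofReal_lt_ofReal_iff_of_nonneg (by positivity)] at ht
  have ht0 : (0 : ℝ) < t := lt_of_le_of_lt (by positivity) h1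
  rw [← ENNReal.ofReal_coe_nnreal] at ht'
  have h2 : ENNReal.ofReal ((t : ℝ) ^ (1 / p)) * ENNReal.ofReal y ≤ ENNReal.ofReal a :=
    (mul_le_mul_right (le_rearrangement_of_lt ht') _).trans
      ((le_iSup₂ (f := fun t (_ : 0 < t) =>
        ENNReal.ofReal (t ^ (1 / p)) * rearrangement h t) (t : ℝ) ht0).trans hA)
  rw [← ENNReal.ofReal_mul (by positivity), ENNReal.ofReal_le_ofReal_iff ha,
    ← le_div_iff₀ hy] at h2
  have h3 := Real.rpow_le_rpow (by positivity) h2 hp.le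
  rw [← Real.rpow_mul ht0.le, one_div_mul_cancel hp.ne', Real.rpow_one] at h3
  linarith

/-- Layer-cake formula: the distribution function on `E` is at most both `ν E` and `(a / t) ^ p`.
Together with its converse `weakNorm_le_of_setLIntegral_le`, this replaces the weak quasi-norm by a
functional that is additive over layers. -/
lemma setLIntegral_enorm_le_of_weakNorm_le [IsFiniteMeasure ν] {p : ℝ} (hp : 1 < p)
    {h : β →ₘ[ν] 𝕜} {A : ℝ≥0∞} (hA : weakNorm p h ≤ A) (E : Set β) :
    ∫⁻ x in E, ‖h x‖ₑ ∂ν ≤ ENNReal.ofReal (p / (p - 1)) * A * ν E ^ (1 - 1 / p) := by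
  have hp0 : 0 < p := by linarith
  have hp1 : 0 < p - 1 := by linarith
  by_cases hE : ν E = 0
  · rw [setLIntegral_measure_zero _ _ hE]
    exact zero_le
  have he : 0 < (ν E).toReal := ENNReal.toReal_pos hE (measure_ne_top ν E)
  have hEe : ν E = ENNReal.ofReal (ν E).toReal := (ENNReal.ofReal_toReal (measure_ne_top ν E)).symm
  generalize (ν E).toReal = e at he hEe
  by_cases hA' : A = ∞
  · have h1 : ENNReal.ofReal (p / (p - 1)) ≠ 0 := by
      simpa using div_pos hp0 hp1
    have h2 : ν E ^ (1 - 1 / p) ≠ 0 := by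
      rw [hEe, ENNReal.ofReal_rpow_of_pos he]
      simpa using Real.rpow_pos_of_pos he _
    rw [hA', ENNReal.mul_top h1, ENNReal.top_mul h2]
    exact le_top
  obtain ⟨a, ha, rfl⟩ : ∃ a : ℝ, 0 ≤ a ∧ A = ENNReal.ofReal a :=
    ⟨A.toReal, ENNReal.toReal_nonneg, (ENNReal.ofReal_toReal hA').symm⟩
  have hlc : ∫⁻ x in E, ‖h x‖ₑ ∂ν =
      ∫⁻ t in Set.Ioi (0 : ℝ), ν.restrict E {x | t < ‖h x‖} := by
    rw [← lintegral_eq_lintegral_meas_lt (ν.restrict E) (.of_forall fun x => norm_nonneg _)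
      h.aestronglyMeasurable.norm.aemeasurable.restrict]
    simp only [ofReal_norm]
  have hle : ∀ t : ℝ, 0 < t → ν.restrict E {x | t < ‖h x‖} ≤ ENNReal.ofReal ((a / t) ^ p) := by
    intro t ht
    refine (Measure.restrict_le_self _).trans
      (le_trans (le_of_eq ?_) (distribution_le_of_weakNorm_le hp0 ha ht hA))
    unfold distribution
    congr 1
    ext x
    simp only [Set.mem_ofPred_eq]
    rw [← ofReal_norm, ENNReal.ofReal_lt_ofReal_iff_of_nonneg ht.le]
  rcases ha.eq_or_lt with rfl | ha
  · refine le_trans (le_of_eq ?_) (zero_le)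
    rw [hlc]
    refine setLIntegral_eq_zero measurableSet_Ioi fun t (ht : 0 < t) => ?_
    simpa [Real.zero_rpow hp0.ne'] using hle t ht
  -- At this level the two bounds agree: `(a / y) ^ p = e`. The first is used below it and the
  -- second above it.
  set y := a * e ^ (-(1 / p)) with hy
  have hy0 : 0 < y := by positivity
  have hint : IntegrableOn (fun t : ℝ => a ^ p * t ^ (-p)) (Set.Ioi y) :=
    (integrableOn_Ioi_rpow_of_lt (by linarith) hy0).const_mul _
  have htail : ∫⁻ t in Set.Ioi y, ENNReal.ofReal ((a / t) ^ p) =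
      ENNReal.ofReal (a ^ p * (y ^ (1 - p) / (p - 1))) := by
    have h1 : ∫ t in Set.Ioi y, a ^ p * t ^ (-p) = a ^ p * (y ^ (1 - p) / (p - 1)) := by
      rw [integral_const_mul, integral_Ioi_rpow_of_lt (by linarith) hy0]
      have e1 : -p + 1 = -(p - 1) := by ring
      have e2 : 1 - p = -(p - 1) := by ring
      rw [e1, e2, div_neg, neg_div, neg_neg]
    rw [← h1, ofReal_integral_eq_lintegral_ofReal hint]
    · refine setLIntegral_congr_fun measurableSet_Ioi fun t (ht : y < t) => ?_
      have ht0 := hy0.trans ht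
      rw [Real.div_rpow ha.le ht0.le, Real.rpow_neg ht0.le, div_eq_mul_inv]
    · filter_upwards [ae_restrict_mem measurableSet_Ioi] with t (ht : y < t)
      have ht0 := hy0.trans ht
      positivity
  have hsplit : Set.Ioi (0 : ℝ) = Set.Ioc 0 y ∪ Set.Ioi y :=
    (Set.Ioc_union_Ioi_eq_Ioi hy0.le).symm
  rw [hlc, hsplit]
  refine (lintegral_union_le _ _ _).trans ?_
  have hhead : ∫⁻ t in Set.Ioc 0 y, ν.restrict E {x | t < ‖h x‖} ≤ ENNReal.ofReal (y * e) := by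
    refine (setLIntegral_mono' (g := fun _ => ν E) measurableSet_Ioc fun t _ =>
      (measure_mono (Set.subset_univ _)).trans_eq (Measure.restrict_apply_univ E)).trans ?_
    rw [setLIntegral_const, Real.volume_Ioc, sub_zero, hEe, ← ENNReal.ofReal_mul he.le, mul_comm]
  have htail' : ∫⁻ t in Set.Ioi y, ν.restrict E {x | t < ‖h x‖} ≤
      ENNReal.ofReal (a ^ p * (y ^ (1 - p) / (p - 1))) :=
    htail ▸ setLIntegral_mono' measurableSet_Ioi fun t ht => hle t (hy0.trans ht)
  refine (add_le_add hhead htail').trans (le_of_eq ?_)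
  rw [← ENNReal.ofReal_add (by positivity) (by positivity), hEe, ENNReal.ofReal_rpow_of_pos he,
    ← ENNReal.ofReal_mul (by positivity), ← ENNReal.ofReal_mul (by positivity)]
  congr 1
  have e1 : y * e = a * e ^ (1 - 1 / p) := by
    rw [hy, mul_assoc, sub_eq_neg_add, Real.rpow_add he, Real.rpow_one]
  have e2 : a ^ p * y ^ (1 - p) = a * e ^ (1 - 1 / p) := by
    rw [hy, Real.mul_rpow ha.le (by positivity), ← Real.rpow_mul he.le, ← mul_assoc,
      ← Real.rpow_add ha]
    have : -(1 / p) * (1 - p) = 1 - 1 / p := by field_simp; ring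
    rw [this, add_sub_cancel, Real.rpow_one]
  rw [e1, ← mul_div_assoc, e2]
  field_simp
  ring

/-- Test the hypothesis on the superlevel set `{y < |h|}`, where the integral is at least `y * ν E`,
and cancel `ν E ^ (1 - 1 / p)`. -/
lemma weakNorm_le_of_setLIntegral_le [IsFiniteMeasure ν] {p : ℝ} (hp : 0 < p)
    {h : β →ₘ[ν] 𝕜} {A : ℝ≥0∞}
    (hA : ∀ E, MeasurableSet E → ∫⁻ x in E, ‖h x‖ₑ ∂ν ≤ A * ν E ^ (1 - 1 / p)) :
    weakNorm p h ≤ A := by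
  refine iSup₂_le fun t ht => ?_
  have ht0 : ENNReal.ofReal (t ^ (1 / p)) ≠ 0 := by simpa using Real.rpow_pos_of_pos ht _
  rw [mul_comm, ← ENNReal.le_div_iff_mul_le (.inl ht0) (.inl ENNReal.ofReal_ne_top)]
  refine rearrangement_le_of_forall fun y hy => ?_
  by_contra! hcon
  refine absurd hy (not_lt.2 ?_)
  rw [ENNReal.le_div_iff_mul_le (.inl ht0) (.inl ENNReal.ofReal_ne_top)]
  set E := {x | y < ‖h x‖ₑ} with hE
  have hd : distribution h y = ν E := rfl
  rw [hd] at hcon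
  have hE0 : ν E ≠ 0 := ((zero_le).trans_lt hcon).ne'
  have hEt : ν E ≠ ∞ := measure_ne_top ν E
  have hmeas : MeasurableSet E :=
    measurableSet_lt measurable_const h.stronglyMeasurable.enorm
  have h1 : y * ν E ≤ A * ν E ^ (1 - 1 / p) := by
    refine le_trans ?_ (hA E hmeas)
    rw [← setLIntegral_const]
    exact setLIntegral_mono' hmeas fun x (hx : y < _) => hx.le
  have h2 : ν E = ν E ^ (1 / p) * ν E ^ (1 - 1 / p) := by
    rw [← ENNReal.rpow_add _ _ hE0 hEt, add_sub_cancel, ENNReal.rpow_one]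
  have h3 : ν E ^ (1 - 1 / p) ≠ 0 := by simp [ENNReal.rpow_eq_zero_iff, hE0, hEt]
  have h4 : ν E ^ (1 - 1 / p) ≠ ∞ := by simp [ENNReal.rpow_eq_top_iff, hE0, hEt]
  have h5 : y * ν E ^ (1 / p) ≤ A := by
    refine (ENNReal.mul_le_mul_iff_left h3 h4).1 ?_
    rwa [mul_assoc, ← h2]
  refine le_trans ?_ h5
  rw [← ENNReal.ofReal_rpow_of_pos ht]
  gcongr

/-- The rearrangement vanishes beyond `V`, so only `t ^ (1/p - 1/q)` with `t < V` matters. The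
exponent lies in `[0, 1]`, which makes the constant independent of `p` and `q`. -/
lemma weakNorm_le_mul_weakNorm {V : ℝ≥0} (hV : ν Set.univ ≤ V) {p q : ℝ} (hp : 1 < p)
    (hpq : p ≤ q) (h : β →ₘ[ν] 𝕜) :
    weakNorm p h ≤ ENNReal.ofReal (max (V : ℝ) 1) * weakNorm q h := by
  refine iSup₂_le fun t ht => ?_
  rcases le_or_gt (V : ℝ) t with hVt | hVt
  · rw [rearrangement_eq_zero]
    · simp
    · refine (measure_mono (Set.subset_univ _)).trans (hV.trans ?_)
      rw [← ENNReal.ofReal_coe_nnreal]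
      exact ENNReal.ofReal_le_ofReal hVt
  · refine le_trans ?_ (mul_le_mul_right (le_iSup₂ (f := fun t (_ : 0 < t) =>
      ENNReal.ofReal (t ^ (1 / q)) * rearrangement h t) t ht) _)
    rw [← mul_assoc, ← ENNReal.ofReal_mul (by positivity)]
    refine mul_le_mul_left (ENNReal.ofReal_le_ofReal ?_) _
    have h1 : t ^ (1 / p) = t ^ (1 / p - 1 / q) * t ^ (1 / q) := by
      rw [← Real.rpow_add ht, sub_add_cancel]
    have hq : 1 / q ≤ 1 / p := one_div_le_one_div_of_le (by linarith) hpq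
    have hp' : 1 / p ≤ 1 := by rw [div_le_one (by linarith)]; exact hp.le
    have hq0 : 0 < 1 / q := by have : 0 < q := by linarith
                               positivity
    rw [h1]
    gcongr
    calc t ^ (1 / p - 1 / q) ≤ (max (V : ℝ) 1) ^ (1 / p - 1 / q) :=
          Real.rpow_le_rpow ht.le (hVt.le.trans (le_max_left _ _)) (by linarith)
      _ ≤ (max (V : ℝ) 1) ^ (1 : ℝ) :=
          Real.rpow_le_rpow_of_exponent_le (le_max_right _ _) (by linarith)
      _ = _ := Real.rpow_one _

lemma ae_le_of_ae_le_add {a b : β → ℝ≥0∞} {e : ℕ → β → ℝ≥0∞} (ha : AEMeasurable a ν)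
    (hb : AEMeasurable b ν) (h : ∀ n, ∀ᵐ y ∂ν, a y ≤ b y + e n y)
    (he : Tendsto (fun n => ∫⁻ y, e n y ∂ν) atTop (𝓝 0)) : ∀ᵐ y ∂ν, a y ≤ b y := by
  have h0 : ∫⁻ y, (a - b) y ∂ν = 0 := by
    refine le_antisymm (ge_of_tendsto' he fun n => lintegral_mono_ae ?_) (zero_le)
    filter_upwards [h n] with y hy
    exact tsub_le_iff_left.2 hy
  rw [lintegral_eq_zero_iff' (ha.sub hb)] at h0
  filter_upwards [h0] with y hy
  exact tsub_eq_zero_iff_le.1 hy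

end Target

/-! ### The weights and the growth of admissible functions -/

section Weights

/-- The weight of `L^{p,1}`. -/
noncomputable def powWeight (p : ℝ) (t : ℝ) : ℝ≥0∞ := ENNReal.ofReal (t ^ (1 / p - 1))

/-- The weight of `L^{p,1} φ(log L)`. -/
noncomputable def logWeight (φ : ℝ → ℝ) (p : ℝ) (t : ℝ) : ℝ≥0∞ :=
  ENNReal.ofReal (φ (1 + Real.posLog (1 / t))) * ENNReal.ofReal (t ^ (1 / p - 1))

lemma powWeight_antitoneOn {p : ℝ} (hp : 1 < p) : AntitoneOn (powWeight p) (Set.Ioi 0) := by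
  intro s hs t _ hst
  refine ENNReal.ofReal_le_ofReal (Real.rpow_le_rpow_of_nonpos hs hst ?_)
  have : 1 / p ≤ 1 := by rw [div_le_one (by linarith)]; exact hp.le
  linarith

lemma powWeight_ne_zero (p : ℝ) {t : ℝ} (ht : 0 < t) : powWeight p t ≠ 0 := by
  simpa [powWeight] using Real.rpow_pos_of_pos ht _

lemma setLIntegral_powWeight {p : ℝ} (hp : 0 < p) {s : ℝ} (hs : 0 ≤ s) :
    ∫⁻ t in Set.Ioc 0 s, powWeight p t = ENNReal.ofReal (p * s ^ (1 / p)) := by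
  have hp' : 0 < 1 / p := by positivity
  have hint := intervalIntegral.intervalIntegrable_rpow' (a := 0) (b := s)
    (r := 1 / p - 1) (by linarith)
  rw [intervalIntegrable_iff_integrableOn_Ioc_of_le hs] at hint
  unfold powWeight
  rw [← ofReal_integral_eq_lintegral_ofReal hint,
    ← intervalIntegral.integral_of_le hs, integral_rpow (.inl (by linarith)), sub_add_cancel,
    Real.zero_rpow hp'.ne', sub_zero]
  · congr 1
    field_simp
  · filter_upwards [ae_restrict_mem measurableSet_Ioc] with t ht
    exact Real.rpow_nonneg ht.1.le _

variable {φ : ℝ → ℝ}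

lemma Admissible.continuousOn (hφ : Admissible φ) : ContinuousOn φ (Set.Ici 1) := by
  obtain ⟨γ, β, _, _, h⟩ := hφ.log_deriv
  intro x hx
  obtain ⟨d, hd, _⟩ := h x hx
  exact hd.continuousWithinAt

lemma Admissible.monotoneOn (hφ : Admissible φ) : MonotoneOn φ (Set.Ici 1) := by
  obtain ⟨γ, β, hγ, _, h⟩ := hφ.log_deriv
  have key : ∀ x, 1 < x → ∃ d, HasDerivAt φ d x ∧ 0 ≤ d := by
    intro x hx
    obtain ⟨d, hd, hd', _⟩ := h x hx.le
    refine ⟨d, hd.hasDerivAt (Ici_mem_nhds hx), ?_⟩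
    have h1 := hφ.one_le x hx.le
    have h2 : 0 ≤ d / φ x := le_trans (by positivity) hd'
    have := mul_nonneg h2 (by linarith : 0 ≤ φ x)
    rwa [div_mul_cancel₀ _ (by linarith)] at this
  refine monotoneOn_of_deriv_nonneg (convex_Ici 1) hφ.continuousOn ?_ ?_
  · intro x hx
    rw [interior_Ici] at hx
    exact (key x hx).choose_spec.1.differentiableAt.differentiableWithinAt
  · intro x hx
    rw [interior_Ici] at hx
    obtain ⟨d, hd, h0⟩ := key x hx
    rwa [hd.deriv]

/-- The upper bound on the logarithmic derivative makes `φ x * x ^ (-β)` nonincreasing. -/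
lemma Admissible.exists_growth (hφ : Admissible φ) :
    ∃ β : ℝ, 0 < β ∧ ∀ c x : ℝ, 1 ≤ c → 1 ≤ x → φ (c * x) ≤ c ^ β * φ x := by
  obtain ⟨γ, β, _, hβ, h⟩ := hφ.log_deriv
  refine ⟨β, hβ, fun c x hc hx => ?_⟩
  have key : ∀ x, 1 < x → ∃ d, HasDerivAt (fun x => φ x * x ^ (-β)) d x ∧ d ≤ 0 := by
    intro x hx
    obtain ⟨d, hd, _, hd'⟩ := h x hx.le
    have hx0 : 0 < x := by linarith
    have h1 := hφ.one_le x hx.le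
    refine ⟨_, (hd.hasDerivAt (Ici_mem_nhds hx)).mul
      (Real.hasDerivAt_rpow_const (.inl hx0.ne')), ?_⟩
    rw [div_le_div_iff₀ (by linarith) hx0] at hd'
    have h2 : x ^ (-β) = x * x ^ (-β - 1) := by
      rw [Real.rpow_sub hx0, Real.rpow_one]; field_simp
    rw [h2]
    have h3 : 0 < x ^ (-β - 1) := by positivity
    nlinarith
  have hanti : AntitoneOn (fun x => φ x * x ^ (-β)) (Set.Ici 1) := by
    refine antitoneOn_of_deriv_nonpos (convex_Ici 1) ?_ ?_ ?_
    · refine hφ.continuousOn.mul (continuousOn_id.rpow_const fun x hx => .inl ?_)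
      exact (lt_of_lt_of_le one_pos hx).ne'
    · intro x hx
      rw [interior_Ici] at hx
      exact (key x hx).choose_spec.1.differentiableAt.differentiableWithinAt
    · intro x hx
      rw [interior_Ici] at hx
      obtain ⟨d, hd, h0⟩ := key x hx
      rwa [hd.deriv]
  have hx0 : 0 < x := by linarith
  have hc0 : 0 < c := by linarith
  have h1 := hanti (Set.mem_Ici.2 hx) (Set.mem_Ici.2 (by nlinarith : 1 ≤ c * x))
    (by nlinarith : x ≤ c * x)
  simp only [Real.mul_rpow hc0.le hx0.le] at h1
  rw [Real.rpow_neg hc0.le, ← mul_assoc] at h1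
  have h2 := le_of_mul_le_mul_right h1 (Real.rpow_pos_of_pos hx0 (-β))
  rw [← div_eq_mul_inv, div_le_iff₀ (by positivity)] at h2
  linarith

lemma one_le_one_add_posLog (x : ℝ) : 1 ≤ 1 + Real.posLog x := by
  linarith [Real.posLog_nonneg (x := x)]

lemma Admissible.comp_posLog_antitoneOn (hφ : Admissible φ) {s t : ℝ} (hs : 0 < s)
    (hst : s ≤ t) : φ (1 + Real.posLog (1 / t)) ≤ φ (1 + Real.posLog (1 / s)) := by
  refine hφ.monotoneOn (one_le_one_add_posLog _) (one_le_one_add_posLog _) ?_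
  refine add_le_add_right ?_ _
  exact Real.monotoneOn_posLog (Set.mem_Ici.2 (by have := hs.trans_le hst; positivity))
    (Set.mem_Ici.2 (by positivity)) (one_div_le_one_div_of_le hs hst)

lemma logWeight_antitoneOn (hφ : Admissible φ) {p : ℝ} (hp : 1 < p) :
    AntitoneOn (logWeight φ p) (Set.Ioi 0) := fun _ hs _ ht hst =>
  mul_le_mul' (ENNReal.ofReal_le_ofReal (hφ.comp_posLog_antitoneOn hs hst))
    (powWeight_antitoneOn hp hs ht hst)

lemma powWeight_le_logWeight (hφ : Admissible φ) (p t : ℝ) :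
    powWeight p t ≤ logWeight φ p t := by
  refine le_mul_of_one_le_left (zero_le) ?_
  rw [ENNReal.one_le_ofReal]
  exact hφ.one_le _ (one_le_one_add_posLog _)

lemma logWeight_ne_zero (hφ : Admissible φ) (p : ℝ) {t : ℝ} (ht : 0 < t) :
    logWeight φ p t ≠ 0 :=
  fun h => powWeight_ne_zero p ht (le_antisymm (h ▸ powWeight_le_logWeight hφ p t) (zero_le))

lemma logWeight_ne_top (φ : ℝ → ℝ) (p t : ℝ) : logWeight φ p t ≠ ∞ :=
  ENNReal.mul_ne_top ENNReal.ofReal_ne_top ENNReal.ofReal_ne_top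

/-- The logarithmic factor decreases in `t`, so on `(0, s]` it is at least its value at `s`; the
remaining power integrates to `p * s ^ (1 / p)`. -/
lemma le_setLIntegral_logWeight (hφ : Admissible φ) {p s : ℝ} (hp : 1 < p) (hs : 0 ≤ s) :
    ENNReal.ofReal (s ^ (1 / p) * φ (1 + Real.posLog (1 / s))) ≤
      ∫⁻ t in Set.Ioc 0 s, logWeight φ p t := by
  have h1 := hφ.one_le _ (one_le_one_add_posLog (1 / s))
  calc ENNReal.ofReal (s ^ (1 / p) * φ (1 + Real.posLog (1 / s)))
      ≤ ENNReal.ofReal (φ (1 + Real.posLog (1 / s))) * ENNReal.ofReal (p * s ^ (1 / p)) := by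
        rw [← ENNReal.ofReal_mul (by linarith)]
        refine ENNReal.ofReal_le_ofReal ?_
        have : 0 ≤ s ^ (1 / p) := by positivity
        have h2 : 0 ≤ φ (1 + Real.posLog (1 / s)) * s ^ (1 / p) := mul_nonneg (by linarith) this
        nlinarith
    _ = ∫⁻ t in Set.Ioc 0 s, ENNReal.ofReal (φ (1 + Real.posLog (1 / s))) * powWeight p t := by
        rw [← setLIntegral_powWeight (by linarith) hs, lintegral_const_mul' _ _ (by simp)]
    _ ≤ _ := setLIntegral_mono' measurableSet_Ioc fun t ht =>
        mul_le_mul_left (ENNReal.ofReal_le_ofReal (hφ.comp_posLog_antitoneOn ht.1 ht.2)) _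

section

variable {α 𝕜 : Type*} [MeasurableSpace α] [RCLike 𝕜] {μ : Measure α}

lemma lorentzOneNorm_eq (p : ℝ) (f : α →ₘ[μ] 𝕜) :
    lorentzOneNorm p f = weightedNorm (powWeight p) f := rfl

lemma lorentzLogNorm_eq (φ : ℝ → ℝ) (p : ℝ) (f : α →ₘ[μ] 𝕜) :
    lorentzLogNorm φ p f = weightedNorm (logWeight φ p) f :=
  lintegral_congr fun _ => mul_right_comm _ _ _

end

end Weights

/-! ### Truncations in the domain, dyadic sums and the choice of exponent -/

section Domain

variable {α 𝕜 : Type*} [MeasurableSpace α] [RCLike 𝕜] {μ : Measure α} {φ : ℝ → ℝ}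

lemma powWeight_le_powWeight {p q t : ℝ} (hp : 0 < p) (hpq : p ≤ q) (ht : 1 ≤ t) :
    powWeight q t ≤ powWeight p t := by
  refine ENNReal.ofReal_le_ofReal (Real.rpow_le_rpow_of_exponent_le ht ?_)
  linarith [one_div_le_one_div_of_le hp hpq]

/-- On `(0, 1]` the bound `b` suffices because the power weight is integrable there; beyond 1 the
weight for `p₁` is dominated by the logarithmic weight for `p₀`. Hence bounded truncations lie in
`L^{p₁,1}`. -/
lemma lintegral_powWeight_mul_min_ne_top (hφ : Admissible φ) {p₀ p₁ : ℝ} (hp₀ : 1 < p₀)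
    (hp : p₀ ≤ p₁) {f : α →ₘ[μ] 𝕜} (hf : weightedNorm (logWeight φ p₀) f ≠ ∞) {b : ℝ≥0∞}
    (hb : b ≠ ∞) :
    ∫⁻ t in Set.Ioi (0 : ℝ), powWeight p₁ t * min b (rearrangement f t) ≠ ∞ := by
  rw [← Set.Ioc_union_Ioi_eq_Ioi zero_le_one]
  refine ne_top_of_le_ne_top ?_ (lintegral_union_le _ _ _)
  refine ENNReal.add_ne_top.2 ⟨?_, ?_⟩
  · refine ne_top_of_le_ne_top (b := ∫⁻ t in Set.Ioc (0 : ℝ) 1, powWeight p₁ t * b) ?_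
      (lintegral_mono fun t => mul_le_mul_right (min_le_left _ _) _)
    rw [lintegral_mul_const' _ _ hb, setLIntegral_powWeight (by linarith) zero_le_one]
    exact ENNReal.mul_ne_top ENNReal.ofReal_ne_top hb
  · refine ne_top_of_le_ne_top hf (le_trans (setLIntegral_mono' measurableSet_Ioi
      fun t (ht : 1 < t) => ?_) (lintegral_mono_set (Set.Ioi_subset_Ioi zero_le_one)))
    exact mul_le_mul' ((powWeight_le_powWeight (by linarith) hp ht.le).trans
      (powWeight_le_logWeight hφ p₀ t)) (min_le_right _ _)

lemma rearrangement_cut_le_min (a b : ℝ≥0∞) (f : α →ₘ[μ] 𝕜) (t : ℝ) :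
    rearrangement (cut a b f) t ≤ min b (rearrangement f t) :=
  le_min (rearrangement_le_of_bound (enorm_cut_le_right a b f) t)
    (rearrangement_mono (enorm_cut_le a b f) t)

lemma cut_mem_lorentzOne (hφ : Admissible φ) {p₀ p₁ : ℝ} (hp₀ : 1 < p₀)
    (hp : p₀ ≤ p₁) {f : α →ₘ[μ] 𝕜} (hf : weightedNorm (logWeight φ p₀) f ≠ ∞) (a : ℝ≥0∞)
    {b : ℝ≥0∞} (hb : b ≠ ∞) : cut a b f ∈ LorentzOne 𝕜 μ p₁ :=
  (lintegral_mono fun t => mul_le_mul_right (rearrangement_cut_le_min a b f t) _).trans_lt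
    (lintegral_powWeight_mul_min_ne_top hφ hp₀ hp hf hb).lt_top

lemma tendsto_lorentzOneNorm_cut_zero (hφ : Admissible φ) {p₀ p₁ : ℝ} (hp₀ : 1 < p₀)
    (hp : p₀ ≤ p₁) {f : α →ₘ[μ] 𝕜} (hf : weightedNorm (logWeight φ p₀) f ≠ ∞) {b : ℕ → ℝ≥0∞}
    (hb : Tendsto b atTop (𝓝 0)) :
    Tendsto (fun n => lorentzOneNorm p₁ (cut 0 (b n) f)) atTop (𝓝 0) := by
  refine tendsto_weightedNorm_zero (powWeight_antitoneOn (hp₀.trans_le hp))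
    (fun t _ => ENNReal.ofReal_ne_top) _
    (lintegral_powWeight_mul_min_ne_top hφ hp₀ hp hf ENNReal.one_ne_top) ?_ fun t _ => ?_
  · filter_upwards [hb.eventually (gt_mem_nhds zero_lt_one)] with n hn t _
    exact (rearrangement_cut_le_min _ _ f t).trans (min_le_min_right _ hn.le)
  · exact tendsto_of_tendsto_of_tendsto_of_le_of_le tendsto_const_nhds hb
      (fun _ => zero_le) fun n => rearrangement_le_of_bound (enorm_cut_le_right _ _ f) t

/-- The weight of `L^{p,1}`, restricted to `(0, 1]`. -/
noncomputable def localWeight (p : ℝ) : ℝ → ℝ≥0∞ := (Set.Ioc 0 1).indicator (powWeight p)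

lemma localWeight_antitoneOn {p : ℝ} (hp : 1 < p) : AntitoneOn (localWeight p) (Set.Ioi 0) := by
  intro s hs t ht hst
  by_cases h : t ≤ 1
  · rw [localWeight, Set.indicator_of_mem (Set.mem_Ioc.2 ⟨ht, h⟩),
      Set.indicator_of_mem (Set.mem_Ioc.2 ⟨hs, hst.trans h⟩)]
    exact powWeight_antitoneOn hp hs ht hst
  · rw [localWeight, Set.indicator_of_notMem fun h' => h h'.2]
    exact zero_le

lemma localWeight_le_powWeight (p t : ℝ) : localWeight p t ≤ powWeight p t :=
  Set.indicator_le_self _ _ _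

lemma localWeight_mono {p q : ℝ} (hp : 0 < p) (hpq : p ≤ q) (t : ℝ) :
    localWeight p t ≤ localWeight q t := by
  refine Set.indicator_le_indicator' fun ht => ENNReal.ofReal_le_ofReal ?_
  refine Real.rpow_le_rpow_of_exponent_ge ht.1 ht.2 ?_
  linarith [one_div_le_one_div_of_le hp hpq]

lemma weightedNorm_mono_weight {w w' : ℝ → ℝ≥0∞} (h : ∀ t, w t ≤ w' t) (f : α →ₘ[μ] 𝕜) :
    weightedNorm w f ≤ weightedNorm w' f :=
  lintegral_mono fun t => mul_le_mul_left (h t) _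

lemma weightedNorm_zero (w : ℝ → ℝ≥0∞) : weightedNorm w (0 : α →ₘ[μ] 𝕜) = 0 := by
  have h : ∀ t, rearrangement (0 : α →ₘ[μ] 𝕜) t = 0 := fun t =>
    le_antisymm (rearrangement_le_of_bound
      ((AEEqFun.coeFn_zero (μ := μ) (β := 𝕜)).mono fun x hx => by simp [hx]) t) (zero_le)
  simp [weightedNorm, h]

/-- On `(0, 1]` the weights increase with the exponent, so the local conditions are nested and a
finite sum satisfies the one for its smallest exponent. The global spaces are not nested, which is
why only the local part is kept. -/
lemma exists_localWeight_ne_top_of_mem_lorentzSpan {p₀ p₁ : ℝ} (hp₀ : 1 < p₀) (hp : p₀ < p₁)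
    {f : α →ₘ[μ] 𝕜} (hf : f ∈ lorentzSpan 𝕜 μ p₀ p₁) :
    ∃ q ∈ Set.Ioc p₀ p₁, weightedNorm (localWeight q) f ≠ ∞ := by
  induction hf using Submodule.span_induction with
  | mem x hx =>
    obtain ⟨q, hq, hx⟩ := Set.mem_iUnion₂.1 hx
    exact ⟨q, hq, ne_top_of_le_ne_top hx.ne
      (weightedNorm_mono_weight (localWeight_le_powWeight q) x)⟩
  | zero =>
    refine ⟨p₁, ⟨hp, le_rfl⟩, ?_⟩
    simp [weightedNorm_zero]
  | add x y _ _ hx hy =>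
    obtain ⟨q, hq, hx⟩ := hx
    obtain ⟨r, hr, hy⟩ := hy
    have hm : p₀ < min q r := lt_min hq.1 hr.1
    refine ⟨min q r, ⟨hm, (min_le_left _ _).trans hq.2⟩, ?_⟩
    refine ne_top_of_le_ne_top
      (ENNReal.mul_ne_top ENNReal.ofNat_ne_top (ENNReal.add_ne_top.2 ⟨?_, ?_⟩))
      (weightedNorm_add_le (localWeight_antitoneOn (hp₀.trans hm)) x y)
    · exact ne_top_of_le_ne_top hx
        (weightedNorm_mono_weight (localWeight_mono (by linarith) (min_le_left _ _)) x)
    · exact ne_top_of_le_ne_top hy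
        (weightedNorm_mono_weight (localWeight_mono (by linarith) (min_le_right _ _)) y)
  | smul c x _ hx =>
    obtain ⟨q, hq, hx⟩ := hx
    exact ⟨q, hq, ne_top_of_le_ne_top (ENNReal.mul_ne_top enorm_ne_top hx)
      (weightedNorm_smul_le _ c x)⟩

/-- Above a high level the support has measure at most 1, so the rearrangement vanishes past `t = 1`
and the local integral is a dominating bound. -/
lemma tendsto_lorentzOneNorm_cut_top {w : ℝ → ℝ≥0∞} (hw : AntitoneOn w (Set.Ioi 0))
    (hw0 : ∀ t, 0 < t → w t ≠ 0) {q : ℝ} (hq : 1 < q) {f : α →ₘ[μ] 𝕜}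
    (hf : weightedNorm w f ≠ ∞) (hfq : weightedNorm (localWeight q) f ≠ ∞)
    {a : ℕ → ℝ≥0∞} (ha : Tendsto a atTop (𝓝 ∞)) :
    Tendsto (fun n => lorentzOneNorm q (cut (a n) ∞ f)) atTop (𝓝 0) := by
  refine tendsto_weightedNorm_zero (powWeight_antitoneOn hq) (fun t _ => ENNReal.ofReal_ne_top)
    ((Set.Ioc 0 1).indicator (rearrangement f)) ?_ ?_ fun t ht =>
      tendsto_rearrangement_cut_top (rearrangement_lt_top hw hw0 hf ht) ha
  · refine ne_top_of_le_ne_top hfq (lintegral_mono fun t => ?_)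
    by_cases h : t ∈ Set.Ioc (0 : ℝ) 1 <;> simp [h, localWeight]
  · obtain ⟨y, hy, hy1⟩ := exists_distribution_le (rearrangement_lt_top hw hw0 hf one_pos)
    filter_upwards [ha.eventually (lt_mem_nhds hy)] with n hn t ht
    by_cases h : t ≤ 1
    · rw [Set.indicator_of_mem (Set.mem_Ioc.2 ⟨ht, h⟩)]
      exact rearrangement_mono (enorm_cut_le _ _ f) t
    · rw [rearrangement_cut_eq_zero]
      · exact zero_le
      · exact (distribution_antitone f hn.le).trans (hy1.trans
          (ENNReal.ofReal_le_ofReal (not_le.1 h).le))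

/-- A geometric sum of ratio 2 is at most twice its largest term, and the terms kept are at most
`x`. -/
lemma sum_dyadic_le (c x : ℝ≥0∞) (n : ℕ) :
    ∑ k ∈ Finset.range n, (if 2 ^ k * c ≤ x then 2 ^ k * c else 0) ≤ 2 * x := by
  have hgeom : ∀ n : ℕ, ∑ k ∈ Finset.range n, 2 ^ k * c ≤ 2 ^ n * c := by
    intro n
    induction n with
    | zero => simp
    | succ n ih =>
      rw [Finset.sum_range_succ, pow_succ, mul_two, add_mul]
      exact add_le_add_left ih _
  induction n with
  | zero => simp
  | succ n ih =>
    rw [Finset.sum_range_succ]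
    by_cases h : 2 ^ n * c ≤ x
    · rw [if_pos h, two_mul]
      refine add_le_add ((Finset.sum_le_sum fun k _ => ?_).trans ((hgeom n).trans h)) h
      split_ifs
      · exact le_rfl
      · exact zero_le
    · rwa [if_neg h, add_zero]

/-- A dyadic lower bound for the weighted integral of a rearrangement. -/
lemma sum_dyadic_setLIntegral_le {w : ℝ → ℝ≥0∞} (hw : AntitoneOn w (Set.Ioi 0))
    (f : α →ₘ[μ] 𝕜) (c : ℝ≥0∞) (n : ℕ) :
    ∑ k ∈ Finset.range n, 2 ^ k * c *
      ∫⁻ t in Set.Ioc 0 (distribution f (2 ^ k * c)).toReal, w t ≤ 2 * weightedNorm w f := by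
  have hw' := aemeasurable_weight hw
  have hpiece : ∀ k : ℕ, 2 ^ k * c *
      ∫⁻ t in Set.Ioc 0 (distribution f (2 ^ k * c)).toReal, w t =
      ∫⁻ t in Set.Ioi (0 : ℝ), 2 ^ k * c *
        (Set.Iio (distribution f (2 ^ k * c)).toReal).indicator w t := by
    intro k
    rw [lintegral_const_mul'' _ (hw'.indicator measurableSet_Iio),
      lintegral_indicator measurableSet_Iio,
      Measure.restrict_restrict measurableSet_Iio, Set.inter_comm, Set.Ioi_inter_Iio,
      setLIntegral_congr Ioo_ae_eq_Ioc]
  rw [Finset.sum_congr rfl fun k _ => hpiece k, ← lintegral_finsetSum'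
    (Finset.range n) fun k _ => (hw'.indicator measurableSet_Iio).const_mul (2 ^ k * c),
    weightedNorm, ← lintegral_const_mul' _ _ ENNReal.ofNat_ne_top]
  refine setLIntegral_mono' measurableSet_Ioi fun t (ht : 0 < t) => ?_
  -- Where `t` is below the distribution function at `2 ^ k * c`, that level is at most the
  -- rearrangement at `t`; so pointwise only dyadic levels below the rearrangement contribute.
  calc ∑ k ∈ Finset.range n, 2 ^ k * c *
        (Set.Iio (distribution f (2 ^ k * c)).toReal).indicator w t
      ≤ ∑ k ∈ Finset.range n, w t *
        (if 2 ^ k * c ≤ rearrangement f t then 2 ^ k * c else 0) := by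
        refine Finset.sum_le_sum fun k _ => ?_
        by_cases h : t < (distribution f (2 ^ k * c)).toReal
        · rw [Set.indicator_of_mem (Set.mem_Iio.2 h), if_pos, mul_comm]
          exact le_rearrangement_of_lt ((ENNReal.ofReal_lt_iff_lt_toReal ht.le
            (fun h' => by simp [h'] at h; linarith)).2 h)
        · rw [Set.indicator_of_notMem (by simpa using h), mul_zero]
          exact zero_le
    _ ≤ 2 * (w t * rearrangement f t) := by
        rw [← Finset.mul_sum, mul_left_comm]
        exact mul_le_mul_right (sum_dyadic_le c _ n) _

lemma lorentzOneNorm_cut_le {p : ℝ} (hp : 0 < p) {f : α →ₘ[μ] 𝕜} {a b : ℝ≥0∞}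
    (ha : distribution f a ≠ ∞) (hb : b ≠ ∞) :
    lorentzOneNorm p (cut a b f) ≤
      ENNReal.ofReal (p * (distribution f a).toReal ^ (1 / p)) * b := by
  rw [← setLIntegral_powWeight hp ENNReal.toReal_nonneg, ← lintegral_mul_const' _ _ hb,
    lorentzOneNorm_eq, weightedNorm]
  set s := (distribution f a).toReal with hs
  rw [← Set.Ioc_union_Ioi_eq_Ioi (ENNReal.toReal_nonneg : 0 ≤ s)]
  refine (lintegral_union_le _ _ _).trans ?_
  have h0 : ∫⁻ t in Set.Ioi s, powWeight p t * rearrangement (cut a b f) t = 0 := by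
    refine setLIntegral_eq_zero measurableSet_Ioi fun t (ht : s < t) => ?_
    rw [rearrangement_cut_eq_zero, mul_zero, Pi.zero_apply]
    exact (ENNReal.le_ofReal_iff_toReal_le ha ((ENNReal.toReal_nonneg).trans ht.le)).2 ht.le
  rw [h0, add_zero]
  exact lintegral_mono fun t => mul_le_mul_right
    (rearrangement_le_of_bound (enorm_cut_le_right a b f) t) _

/-- The choice of the exponent adapted to a set of measure `s`. -/
lemma Admissible.exists_exponent (hφ : Admissible φ) {β : ℝ}
    (hβ : ∀ c x : ℝ, 1 ≤ c → 1 ≤ x → φ (c * x) ≤ c ^ β * φ x)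
    {p₀ p₁ P s : ℝ} (hp₀ : 1 < p₀) (hp₀P : p₀ ≤ P) (hP : P < p₁) (hs : 0 ≤ s) :
    ∃ p, p₀ < p ∧ p ≤ p₁ ∧ 0 ≤ φ ((1 / p₀ - 1 / p)⁻¹) ∧
      φ ((1 / p₀ - 1 / p)⁻¹) * (p * s ^ (1 / p)) ≤
        p₁ * Real.exp 1 * (1 / P - 1 / p₁)⁻¹ ^ β *
          (s ^ (1 / p₀) * φ (1 + Real.posLog (1 / s))) := by
  have hP0 : 0 < P := by linarith
  have hp1 : 0 < p₁ := by linarith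
  set δ := 1 / P - 1 / p₁ with hδ
  set L := 1 + Real.posLog (1 / s) with hL
  have hL1 : 1 ≤ L := one_le_one_add_posLog _
  have hL0 : 0 < L := by linarith
  have hδ0 : 0 < δ := sub_pos.2 (one_div_lt_one_div_of_lt hP0 hP)
  have hP1 : 1 / P ≤ 1 := by rw [div_le_one hP0]; linarith
  have hi1 : 0 < 1 / p₁ := by positivity
  have hδ1 : δ ≤ 1 := by linarith
  have hδL : δ / L ≤ δ := div_le_self hδ0.le hL1
  have hδL0 : 0 < δ / L := by positivity
  have hi0 : 1 / P ≤ 1 / p₀ := one_div_le_one_div_of_le (by linarith) hp₀P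
  -- `r` is the reciprocal of the exponent sought. The gap `δ / L` is at most `δ`, so `r ≥ 1 / p₁`
  -- for every `p₀ ≤ P`; and `s ^ (-δ / L) ≤ e ^ δ ≤ e` because `-log s ≤ L`.
  set r := 1 / p₀ - δ / L with hr
  have hr1 : 1 / p₁ ≤ r := by linarith
  have hr0 : 0 < r := by linarith
  have hp : 1 / (1 / r) = r := one_div_one_div r
  have hinv : (1 / p₀ - r)⁻¹ = δ⁻¹ * L := by rw [hr, sub_sub_cancel, inv_div]; field_simp
  have hle : 1 / r ≤ p₁ := by rw [div_le_iff₀ hr0]; rwa [div_le_iff₀ hp1, mul_comm] at hr1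
  have hδi : 1 ≤ δ⁻¹ := (one_le_inv₀ hδ0).2 hδ1
  have hφL := hφ.one_le L hL1
  have hφL' := hφ.one_le (δ⁻¹ * L) (by nlinarith)
  refine ⟨1 / r, ?_, hle, ?_⟩
  · rw [lt_one_div (by linarith) hr0]; linarith
  rw [hp, hinv]
  refine ⟨by linarith, ?_⟩
  have hpow : s ^ r ≤ Real.exp 1 * s ^ (1 / p₀) := by
    rcases hs.eq_or_lt with h | h
    · rw [← h, Real.zero_rpow hr0.ne']; positivity
    · rw [hr, sub_eq_add_neg, add_comm, Real.rpow_add h]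
      refine mul_le_mul_of_nonneg_right ?_ (by positivity)
      rw [Real.rpow_def_of_pos h, Real.exp_le_exp]
      have h1 : -Real.log s ≤ L := by
        have : Real.log (1 / s) ≤ Real.posLog (1 / s) := le_max_right _ _
        rw [one_div, Real.log_inv] at this
        rw [hL, one_div]
        linarith
      calc Real.log s * -(δ / L) = -Real.log s * (δ / L) := by ring
        _ ≤ L * (δ / L) := mul_le_mul_of_nonneg_right h1 hδL0.le
        _ = δ := by field_simp
        _ ≤ 1 := hδ1
  calc φ (δ⁻¹ * L) * (1 / r * s ^ r)
      ≤ (δ⁻¹ ^ β * φ L) * (p₁ * (Real.exp 1 * s ^ (1 / p₀))) := by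
        have h1 : 1 / r * s ^ r ≤ p₁ * (Real.exp 1 * s ^ (1 / p₀)) :=
          mul_le_mul hle hpow (by positivity) hp1.le
        exact mul_le_mul (hβ _ _ hδi hL1) h1 (by positivity)
          (mul_nonneg (by positivity) (by linarith))
    _ = _ := by ring

end Domain

/-! ### Extension of sublinear operators through their moduli -/

section Extension

variable {α β 𝕜 : Type*} [MeasurableSpace α] [MeasurableSpace β] [RCLike 𝕜]
  {μ : Measure α} {ν : Measure β}

lemma SublinearOn.enorm_add_le {D : Set (α →ₘ[μ] 𝕜)} {T : (α →ₘ[μ] 𝕜) → (β →ₘ[ν] 𝕜)}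
    (hT : SublinearOn D T) {f g : α →ₘ[μ] 𝕜} (hf : f ∈ D) (hg : g ∈ D) :
    ∀ᵐ y ∂ν, ‖T (f + g) y‖ₑ ≤ ‖T f y‖ₑ + ‖T g y‖ₑ := by
  filter_upwards [hT.add_le f hf g hg] with y hy
  rw [← ofReal_norm, ← ofReal_norm, ← ofReal_norm,
    ← ENNReal.ofReal_add (norm_nonneg _) (norm_nonneg _)]
  exact ENNReal.ofReal_le_ofReal hy

lemma SublinearOn.setLIntegral_add_le {D : Set (α →ₘ[μ] 𝕜)}
    {T : (α →ₘ[μ] 𝕜) → (β →ₘ[ν] 𝕜)}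
    (hT : SublinearOn D T) {f g : α →ₘ[μ] 𝕜} (hf : f ∈ D) (hg : g ∈ D) (E : Set β) :
    ∫⁻ y in E, ‖T (f + g) y‖ₑ ∂ν ≤ ∫⁻ y in E, ‖T f y‖ₑ ∂ν + ∫⁻ y in E, ‖T g y‖ₑ ∂ν := by
  rw [← lintegral_add_left' (T f).aestronglyMeasurable.enorm.restrict]
  exact lintegral_mono_ae (ae_restrict_of_ae (hT.enorm_add_le hf hg))

/-- Reverse triangle inequality, with homogeneity at `-1` identifying `|T (g - f)|` and `|T (f -
g)|`. It is the substitute for linearity: moduli depend continuously on the argument although `T`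
itself need not. -/
lemma SublinearOn.enorm_norm_sub_norm_le {D : Set (α →ₘ[μ] 𝕜)}
    {T : (α →ₘ[μ] 𝕜) → (β →ₘ[ν] 𝕜)} (hT : SublinearOn D T) {f g : α →ₘ[μ] 𝕜} (hf : f ∈ D)
    (hg : g ∈ D) (hfg : f - g ∈ D) (hgf : g - f ∈ D) :
    ∀ᵐ y ∂ν, ‖‖T f y‖ - ‖T g y‖‖ₑ ≤ ‖T (f - g) y‖ₑ := by
  have h1 := hT.add_le _ hfg _ hg
  have h2 := hT.add_le _ hgf _ hf
  have h3 := hT.smul_eq (-1) _ hfg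
  have h4 : (-1 : 𝕜) • (f - g) = g - f := by
    refine AEEqFun.ext ?_
    filter_upwards [AEEqFun.coeFn_smul (-1 : 𝕜) (f - g), AEEqFun.coeFn_sub f g,
      AEEqFun.coeFn_sub g f] with x e1 e2 e3
    simp [e1, e2, e3]
  rw [h4] at h3
  rw [sub_add_cancel] at h1 h2
  filter_upwards [h1, h2, h3] with y h1 h2 h3
  rw [norm_neg, norm_one, one_mul] at h3
  rw [h3] at h2
  rw [← ofReal_norm, ← ofReal_norm, Real.norm_eq_abs]
  refine ENNReal.ofReal_le_ofReal (abs_le.2 ⟨?_, ?_⟩) <;> linarith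

variable {w : ℝ → ℝ≥0∞} {D : Submodule 𝕜 (α →ₘ[μ] 𝕜)}
  {T : (α →ₘ[μ] 𝕜) → (β →ₘ[ν] 𝕜)} {A : ℝ≥0∞}

lemma lintegral_enorm_norm_sub_norm_le (hw : AntitoneOn w (Set.Ioi 0))
    (hT : SublinearOn (D : Set (α →ₘ[μ] 𝕜)) T)
    (hA : ∀ f ∈ D, weightedNorm w f ≠ ∞ → ∫⁻ y, ‖T f y‖ₑ ∂ν ≤ A * weightedNorm w f)
    {f u v : α →ₘ[μ] 𝕜} (hu : u ∈ D) (hv : v ∈ D) (huf : weightedNorm w (u - f) ≠ ∞)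
    (hvf : weightedNorm w (v - f) ≠ ∞) :
    ∫⁻ y, ‖‖T u y‖ - ‖T v y‖‖ₑ ∂ν ≤
      A * (2 * (weightedNorm w (u - f) + weightedNorm w (v - f))) := by
  have h1 : weightedNorm w (u - v) ≤ 2 * (weightedNorm w (u - f) + weightedNorm w (v - f)) := by
    rw [← sub_sub_sub_cancel_right u v f]
    exact weightedNorm_sub_le hw _ _
  have h2 : weightedNorm w (u - v) ≠ ∞ := ne_top_of_le_ne_top
    (ENNReal.mul_ne_top ENNReal.ofNat_ne_top (ENNReal.add_ne_top.2 ⟨huf, hvf⟩)) h1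
  refine (lintegral_mono_ae (hT.enorm_norm_sub_norm_le hu hv (D.sub_mem hu hv)
    (D.sub_mem hv hu))).trans ((hA _ (D.sub_mem hu hv) h2).trans ?_)
  exact mul_le_mul_right h1 _

lemma tendsto_const_mul_add_zero {A : ℝ≥0∞} (hA : A ≠ ∞) {a b : ℕ → ℝ≥0∞}
    (ha : Tendsto a atTop (𝓝 0)) (hb : Tendsto b atTop (𝓝 0)) :
    Tendsto (fun n => A * (2 * (a n + b n))) atTop (𝓝 0) := by
  have h := ENNReal.Tendsto.const_mul (ENNReal.Tendsto.const_mul (ha.add hb)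
    (.inr (ENNReal.ofNat_ne_top (n := 2)))) (.inr hA)
  simpa using h

lemma aemeasurable_enorm_norm_sub_norm (g h : β →ₘ[ν] 𝕜) :
    AEMeasurable (fun y => ‖‖g y‖ - ‖h y‖‖ₑ) ν :=
  (g.aestronglyMeasurable.norm.sub h.aestronglyMeasurable.norm).enorm

lemma enorm_norm_sub_norm_comm (a b : 𝕜) : ‖‖a‖ - ‖b‖‖ₑ = ‖‖b‖ - ‖a‖‖ₑ := by
  rw [← enorm_neg, neg_sub]

lemma enorm_le_add_enorm_norm_sub_norm (a b : 𝕜) : ‖a‖ₑ ≤ ‖b‖ₑ + ‖‖a‖ - ‖b‖‖ₑ := by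
  have h := enorm_add_le ‖b‖ (‖a‖ - ‖b‖)
  rwa [add_sub_cancel, enorm_norm, enorm_norm] at h

/-- The moduli of the values of `T` along approximating sequences converge in `L¹`. -/
lemma exists_limit_modulus (hw : AntitoneOn w (Set.Ioi 0))
    (hT : SublinearOn (D : Set (α →ₘ[μ] 𝕜)) T) (hAt : A ≠ ∞)
    (hA : ∀ f ∈ D, weightedNorm w f ≠ ∞ → ∫⁻ y, ‖T f y‖ₑ ∂ν ≤ A * weightedNorm w f)
    {f : α →ₘ[μ] 𝕜} {u : ℕ → (α →ₘ[μ] 𝕜)} (hu : ∀ n, u n ∈ D)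
    (hut : ∀ n, weightedNorm w (u n) ≠ ∞) (hft : weightedNorm w f ≠ ∞)
    (huf : Tendsto (fun n => weightedNorm w (u n - f)) atTop (𝓝 0)) :
    ∃ h : β →ₘ[ν] 𝕜, ∀ v : ℕ → (α →ₘ[μ] 𝕜), (∀ n, v n ∈ D) →
      (∀ n, weightedNorm w (v n) ≠ ∞) →
      Tendsto (fun n => weightedNorm w (v n - f)) atTop (𝓝 0) →
      Tendsto (fun n => ∫⁻ y, ‖‖T (v n) y‖ - ‖h y‖‖ₑ ∂ν) atTop (𝓝 0) := by
  have hsub : ∀ {g : α →ₘ[μ] 𝕜}, weightedNorm w g ≠ ∞ → weightedNorm w (g - f) ≠ ∞ :=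
    fun hg => ne_top_of_le_ne_top
      (ENNReal.mul_ne_top ENNReal.ofNat_ne_top (ENNReal.add_ne_top.2 ⟨hg, hft⟩))
      (weightedNorm_sub_le hw _ _)
  have hmem : ∀ n, MemLp (fun y => ‖T (u n) y‖) 1 ν := fun n =>
    ⟨(T (u n)).aestronglyMeasurable.norm, by
      rw [eLpNorm_one_eq_lintegral_enorm]
      simp only [enorm_norm]
      exact (hA _ (hu n) (hut n)).trans_lt (ENNReal.mul_lt_top hAt.lt_top (hut n).lt_top)⟩
  let F : ℕ → Lp ℝ 1 ν := fun n => (hmem n).toLp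
  have hdist : ∀ n m, edist (F n) (F m) ≤
      A * (2 * (weightedNorm w (u n - f) + weightedNorm w (u m - f))) := by
    intro n m
    rw [Lp.edist_toLp_toLp, eLpNorm_one_eq_lintegral_enorm]
    exact lintegral_enorm_norm_sub_norm_le hw hT hA (hu n) (hu m) (hsub (hut n)) (hsub (hut m))
  have hcauchy : CauchySeq F := by
    rw [EMetric.cauchySeq_iff]
    intro ε hε
    have h1 : Tendsto (fun p : ℕ × ℕ =>
        A * (2 * (weightedNorm w (u p.1 - f) + weightedNorm w (u p.2 - f)))) atTop (𝓝 0) := by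
      rw [← prod_atTop_atTop_eq]
      have h := ENNReal.Tendsto.const_mul (ENNReal.Tendsto.const_mul
        ((huf.comp tendsto_fst).add (huf.comp tendsto_snd))
        (.inr (ENNReal.ofNat_ne_top (n := 2)))) (.inr hAt)
      simpa using h
    obtain ⟨⟨N, M⟩, h2⟩ := eventually_atTop.1 (h1.eventually (gt_mem_nhds hε))
    exact ⟨max N M, fun m hm n hn => (hdist m n).trans_lt
      (h2 (m, n) ⟨(le_max_left _ _).trans hm, (le_max_right _ _).trans hn⟩)⟩
  obtain ⟨h₀, hh₀⟩ := cauchySeq_tendsto_of_complete hcauchy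
  have hlim : Tendsto (fun n => ∫⁻ y, ‖‖T (u n) y‖ - h₀ y‖ₑ ∂ν) atTop (𝓝 0) := by
    refine (tendsto_iff_edist_tendsto_0.1 hh₀).congr fun n => ?_
    rw [Lp.edist_def, eLpNorm_one_eq_lintegral_enorm]
    refine lintegral_congr_ae ?_
    filter_upwards [(hmem n).coeFn_toLp] with y hy
    simp only [Pi.sub_apply, F, hy]
  -- The real limit is regarded as `𝕜`-valued. Its sign need not be determined, since comparing with
  -- `|h₀|` only decreases the distance to the nonnegative functions `|T (u n)|`.
  refine ⟨AEEqFun.comp (fun x : ℝ => (x : 𝕜)) RCLike.continuous_ofReal (h₀ : β →ₘ[ν] ℝ),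
    fun v hv hvt hvf => ?_⟩
  have hsum := (tendsto_const_mul_add_zero hAt hvf huf).add hlim
  rw [add_zero] at hsum
  refine tendsto_of_tendsto_of_tendsto_of_le_of_le tendsto_const_nhds hsum
    (fun _ => zero_le) fun n => ?_
  refine le_trans ?_ (add_le_add_left (lintegral_enorm_norm_sub_norm_le hw hT hA (hv n) (hu n)
    (hsub (hvt n)) (hsub (hut n))) _)
  rw [← lintegral_add_left' (aemeasurable_enorm_norm_sub_norm (T (v n)) (T (u n)))]
  refine lintegral_mono_ae ?_
  filter_upwards [AEEqFun.coeFn_comp (fun x : ℝ => (x : 𝕜)) RCLike.continuous_ofReal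
    (h₀ : β →ₘ[ν] ℝ)] with y hy
  rw [hy, Function.comp_apply, RCLike.norm_ofReal]
  have hn : 0 ≤ ‖T (u n) y‖ := norm_nonneg _
  have h1 := enorm_add_le (‖T (v n) y‖ - ‖T (u n) y‖) (‖T (u n) y‖ - |h₀ y|)
  rw [sub_add_sub_cancel] at h1
  refine h1.trans (add_le_add_right ?_ _)
  rw [← ofReal_norm, ← ofReal_norm]
  refine ENNReal.ofReal_le_ofReal ?_
  rw [Real.norm_eq_abs, Real.norm_eq_abs]
  conv_lhs => rw [← abs_of_nonneg hn]
  exact abs_abs_sub_abs_le_abs_sub _ _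

/-- A sublinear operator that is bounded into `L¹` on a dense subspace extends to the whole
space, with the same bounds for the integrals over each set. -/
theorem exists_sublinear_extension (hw : AntitoneOn w (Set.Ioi 0))
    (hT : SublinearOn (D : Set (α →ₘ[μ] 𝕜)) T) (hAt : A ≠ ∞)
    (hA : ∀ f ∈ D, weightedNorm w f ≠ ∞ → ∫⁻ y, ‖T f y‖ₑ ∂ν ≤ A * weightedNorm w f)
    (hD : ∀ f : α →ₘ[μ] 𝕜, weightedNorm w f ≠ ∞ → ∃ u : ℕ → (α →ₘ[μ] 𝕜),
      (∀ n, u n ∈ D) ∧ (∀ n, weightedNorm w (u n) ≤ weightedNorm w f) ∧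
      Tendsto (fun n => weightedNorm w (u n - f)) atTop (𝓝 0)) :
    ∃ S : (α →ₘ[μ] 𝕜) → (β →ₘ[ν] 𝕜),
      SublinearOn {f | weightedNorm w f ≠ ∞} S ∧
      (∀ f ∈ D, weightedNorm w f ≠ ∞ → S f = T f) ∧
      (∀ (E : Set β) (B : ℝ≥0∞),
        (∀ f ∈ D, weightedNorm w f ≠ ∞ → ∫⁻ y in E, ‖T f y‖ₑ ∂ν ≤ B * weightedNorm w f) →
        ∀ f, weightedNorm w f ≠ ∞ → ∫⁻ y in E, ‖S f y‖ₑ ∂ν ≤ B * weightedNorm w f) ∧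
      ∀ S' : (α →ₘ[μ] 𝕜) → (β →ₘ[ν] 𝕜), SublinearOn {f | weightedNorm w f ≠ ∞} S' →
        (∀ f ∈ D, weightedNorm w f ≠ ∞ → S' f = T f) →
        (∀ u : ℕ → (α →ₘ[μ] 𝕜), Tendsto (fun n => weightedNorm w (u n)) atTop (𝓝 0) →
          TendstoInMeasure ν (fun n => (S' (u n) : β → 𝕜)) atTop (fun _ => 0)) →
        ∀ f, weightedNorm w f ≠ ∞ → ∀ᵐ y ∂ν, ‖S' f y‖ = ‖S f y‖ := by
  have hadd : ∀ {f g : α →ₘ[μ] 𝕜}, weightedNorm w f ≠ ∞ → weightedNorm w g ≠ ∞ →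
      weightedNorm w (f + g) ≠ ∞ := fun hf hg => ne_top_of_le_ne_top
    (ENNReal.mul_ne_top ENNReal.ofNat_ne_top (ENNReal.add_ne_top.2 ⟨hf, hg⟩))
      (weightedNorm_add_le hw _ _)
  have hsub : ∀ {f g : α →ₘ[μ] 𝕜}, weightedNorm w f ≠ ∞ → weightedNorm w g ≠ ∞ →
      weightedNorm w (f - g) ≠ ∞ := fun hf hg => ne_top_of_le_ne_top
    (ENNReal.mul_ne_top ENNReal.ofNat_ne_top (ENNReal.add_ne_top.2 ⟨hf, hg⟩))
      (weightedNorm_sub_le hw _ _)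
  have hsmul : ∀ (c : 𝕜) {f : α →ₘ[μ] 𝕜}, weightedNorm w f ≠ ∞ →
      weightedNorm w (c • f) ≠ ∞ := fun c f hf => ne_top_of_le_ne_top
    (ENNReal.mul_ne_top enorm_ne_top hf) (weightedNorm_smul_le w c f)
  -- On `D` the value `T f` itself must be chosen, so that `S` extends `T` and not only its modulus;
  -- elsewhere any function with the limiting modulus serves.
  have hex : ∀ f : α →ₘ[μ] 𝕜, ∃ h : β →ₘ[ν] 𝕜, (f ∈ D → h = T f) ∧
      (weightedNorm w f ≠ ∞ → ∀ v : ℕ → (α →ₘ[μ] 𝕜), (∀ n, v n ∈ D) →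
        (∀ n, weightedNorm w (v n) ≠ ∞) →
        Tendsto (fun n => weightedNorm w (v n - f)) atTop (𝓝 0) →
        Tendsto (fun n => ∫⁻ y, ‖‖T (v n) y‖ - ‖h y‖‖ₑ ∂ν) atTop (𝓝 0)) := by
    intro f
    by_cases hfD : f ∈ D
    · refine ⟨T f, fun _ => rfl, fun hf v hv hvt hvf => ?_⟩
      have h0 : Tendsto (fun _ : ℕ => weightedNorm w (f - f)) atTop (𝓝 0) := by
        simp only [sub_self, weightedNorm_zero]
        exact tendsto_const_nhds
      exact tendsto_of_tendsto_of_tendsto_of_le_of_le tendsto_const_nhds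
        (tendsto_const_mul_add_zero hAt hvf h0) (fun _ => zero_le) fun n =>
        lintegral_enorm_norm_sub_norm_le hw hT hA (hv n) hfD (hsub (hvt n) hf) (hsub hf hf)
    · by_cases hf : weightedNorm w f = ∞
      · exact ⟨0, fun h => absurd h hfD, fun h => absurd hf h⟩
      · obtain ⟨u, hu, hut, huf⟩ := hD f hf
        obtain ⟨h, hh⟩ := exists_limit_modulus hw hT hAt hA hu
          (fun n => ne_top_of_le_ne_top hf (hut n)) hf huf
        exact ⟨h, fun h' => absurd h' hfD, fun _ => hh⟩
  choose S hST hS using hex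
  refine ⟨S, ⟨fun f hf g hg => ?_, fun c f hf => ?_⟩, fun f hf _ => hST f hf, ?_, ?_⟩
  · obtain ⟨u, hu, hut, huf⟩ := hD f hf
    obtain ⟨v, hv, hvt, hvg⟩ := hD g hg
    have hut' := fun n => ne_top_of_le_ne_top hf (hut n)
    have hvt' := fun n => ne_top_of_le_ne_top hg (hvt n)
    have huv : Tendsto (fun n => weightedNorm w (u n + v n - (f + g))) atTop (𝓝 0) := by
      have h := tendsto_const_mul_add_zero ENNReal.one_ne_top huf hvg
      simp only [one_mul] at h
      refine tendsto_of_tendsto_of_tendsto_of_le_of_le tendsto_const_nhds h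
        (fun _ => zero_le) fun n => ?_
      rw [add_sub_add_comm]
      exact weightedNorm_add_le hw _ _
    have h1 := hS f hf u hu hut' huf
    have h2 := hS g hg v hv hvt' hvg
    have h3 := hS (f + g) (hadd hf hg) (fun n => u n + v n) (fun n => D.add_mem (hu n) (hv n))
      (fun n => hadd (hut' n) (hvt' n)) huv
    have h4 := (h1.add h2).add h3
    simp only [add_zero] at h4
    have key := ae_le_of_ae_le_add (ν := ν) (a := fun y => ‖S (f + g) y‖ₑ)
      (b := fun y => ‖S f y‖ₑ + ‖S g y‖ₑ)
      (e := fun n y => (‖‖T (u n) y‖ - ‖S f y‖‖ₑ + ‖‖T (v n) y‖ - ‖S g y‖‖ₑ) +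
        ‖‖T (u n + v n) y‖ - ‖S (f + g) y‖‖ₑ)
      (S (f + g)).aestronglyMeasurable.enorm
      ((S f).aestronglyMeasurable.enorm.add (S g).aestronglyMeasurable.enorm) ?_ ?_
    · filter_upwards [key] with y hy
      simp only [← ofReal_norm] at hy
      rwa [← ENNReal.ofReal_add (norm_nonneg _) (norm_nonneg _),
        ENNReal.ofReal_le_ofReal_iff (by positivity)] at hy
    · intro n
      filter_upwards [hT.enorm_add_le (hu n) (hv n)] with y hy
      calc ‖S (f + g) y‖ₑ ≤ ‖T (u n + v n) y‖ₑ + ‖‖T (u n + v n) y‖ - ‖S (f + g) y‖‖ₑ := by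
            rw [enorm_norm_sub_norm_comm]
            exact enorm_le_add_enorm_norm_sub_norm _ _
        _ ≤ ((‖S f y‖ₑ + ‖‖T (u n) y‖ - ‖S f y‖‖ₑ) +
            (‖S g y‖ₑ + ‖‖T (v n) y‖ - ‖S g y‖‖ₑ)) +
              ‖‖T (u n + v n) y‖ - ‖S (f + g) y‖‖ₑ := by
            gcongr
            exact hy.trans (add_le_add (enorm_le_add_enorm_norm_sub_norm _ _)
              (enorm_le_add_enorm_norm_sub_norm _ _))
        _ = _ := by ring
    · refine h4.congr fun n => ?_
      rw [lintegral_add_right' _ (aemeasurable_enorm_norm_sub_norm _ _),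
        lintegral_add_right' _ (aemeasurable_enorm_norm_sub_norm _ _)]
  · obtain ⟨u, hu, hut, huf⟩ := hD f hf
    have hut' := fun n => ne_top_of_le_ne_top hf (hut n)
    have hcu : Tendsto (fun n => weightedNorm w (c • u n - c • f)) atTop (𝓝 0) := by
      have h := ENNReal.Tendsto.const_mul huf (.inr (enorm_ne_top (x := c)))
      rw [mul_zero] at h
      refine tendsto_of_tendsto_of_tendsto_of_le_of_le tendsto_const_nhds h
        (fun _ => zero_le) fun n => ?_
      have : c • u n - c • f = c • (u n - f) := (smul_sub c (u n) f).symm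
      rw [this]
      exact weightedNorm_smul_le w c _
    have h1 := ENNReal.Tendsto.const_mul (hS f hf u hu hut' huf)
      (.inr (enorm_ne_top (x := c)))
    have h2 := hS (c • f) (hsmul c hf) (fun n => c • u n) (fun n => D.smul_mem c (hu n))
      (fun n => hsmul c (hut' n)) hcu
    have h3 := h1.add h2
    simp only [mul_zero, add_zero] at h3
    have hTe : ∀ n, ∀ᵐ y ∂ν, ‖T (c • u n) y‖ₑ = ‖c‖ₑ * ‖T (u n) y‖ₑ := by
      intro n
      filter_upwards [hT.smul_eq c (u n) (hu n)] with y hy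
      rw [← ofReal_norm, hy, ENNReal.ofReal_mul (norm_nonneg _), ofReal_norm, ofReal_norm]
    have htend : Tendsto (fun n => ∫⁻ y, (‖c‖ₑ * ‖‖T (u n) y‖ - ‖S f y‖‖ₑ +
        ‖‖T (c • u n) y‖ - ‖S (c • f) y‖‖ₑ) ∂ν) atTop (𝓝 0) := by
      refine h3.congr fun n => ?_
      rw [lintegral_add_right' _ (aemeasurable_enorm_norm_sub_norm _ _),
        lintegral_const_mul' _ _ enorm_ne_top]
    have k1 := ae_le_of_ae_le_add (ν := ν) (a := fun y => ‖S (c • f) y‖ₑ)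
      (b := fun y => ‖c‖ₑ * ‖S f y‖ₑ)
      (S (c • f)).aestronglyMeasurable.enorm ((S f).aestronglyMeasurable.enorm.const_mul _)
      (fun n => by
        filter_upwards [hTe n] with y hy
        calc ‖S (c • f) y‖ₑ ≤ ‖T (c • u n) y‖ₑ + ‖‖T (c • u n) y‖ - ‖S (c • f) y‖‖ₑ := by
              rw [enorm_norm_sub_norm_comm]
              exact enorm_le_add_enorm_norm_sub_norm _ _
          _ ≤ ‖c‖ₑ * (‖S f y‖ₑ + ‖‖T (u n) y‖ - ‖S f y‖‖ₑ) +
                ‖‖T (c • u n) y‖ - ‖S (c • f) y‖‖ₑ := by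
              rw [hy]
              gcongr
              exact enorm_le_add_enorm_norm_sub_norm _ _
          _ = _ := by rw [mul_add, add_assoc]) htend
    have k2 := ae_le_of_ae_le_add (ν := ν) (b := fun y => ‖S (c • f) y‖ₑ)
      (a := fun y => ‖c‖ₑ * ‖S f y‖ₑ)
      ((S f).aestronglyMeasurable.enorm.const_mul _) (S (c • f)).aestronglyMeasurable.enorm
      (fun n => by
        filter_upwards [hTe n] with y hy
        calc ‖c‖ₑ * ‖S f y‖ₑ ≤ ‖c‖ₑ * (‖T (u n) y‖ₑ + ‖‖T (u n) y‖ - ‖S f y‖‖ₑ) := by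
              gcongr
              rw [enorm_norm_sub_norm_comm]
              exact enorm_le_add_enorm_norm_sub_norm _ _
          _ ≤ (‖S (c • f) y‖ₑ + ‖‖T (c • u n) y‖ - ‖S (c • f) y‖‖ₑ) +
                ‖c‖ₑ * ‖‖T (u n) y‖ - ‖S f y‖‖ₑ := by
              rw [mul_add, ← hy]
              gcongr
              exact enorm_le_add_enorm_norm_sub_norm _ _
          _ = _ := by rw [add_assoc, add_comm (‖‖T (c • u n) y‖ - ‖S (c • f) y‖‖ₑ)]) htend
    filter_upwards [k1, k2] with y h1 h2
    have h := congrArg ENNReal.toReal (le_antisymm h1 h2)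
    simpa using h
  · intro E B hB f hf
    obtain ⟨u, hu, hut, huf⟩ := hD f hf
    have h1 := hS f hf u hu (fun n => ne_top_of_le_ne_top hf (hut n)) huf
    have h2 := h1.const_add (B * weightedNorm w f)
    rw [add_zero] at h2
    refine ge_of_tendsto' h2 fun n => ?_
    calc ∫⁻ y in E, ‖S f y‖ₑ ∂ν
        ≤ ∫⁻ y in E, (‖T (u n) y‖ₑ + ‖‖T (u n) y‖ - ‖S f y‖‖ₑ) ∂ν :=
          lintegral_mono fun y => by
            rw [enorm_norm_sub_norm_comm]
            exact enorm_le_add_enorm_norm_sub_norm _ _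
      _ = ∫⁻ y in E, ‖T (u n) y‖ₑ ∂ν + ∫⁻ y in E, ‖‖T (u n) y‖ - ‖S f y‖‖ₑ ∂ν :=
          lintegral_add_right' _ (aemeasurable_enorm_norm_sub_norm _ _).restrict
      _ ≤ _ := add_le_add ((hB _ (hu n) (ne_top_of_le_ne_top hf (hut n))).trans
          (mul_le_mul_right (hut n) _)) (setLIntegral_le_lintegral _ _)
  · intro S' hS' hS'T hS'0 f hf
    obtain ⟨u, hu, hut, huf⟩ := hD f hf
    have hut' := fun n => ne_top_of_le_ne_top hf (hut n)
    have h1 := hS f hf u hu hut' huf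
    obtain ⟨ns, hns, hae⟩ := (hS'0 (fun n => u n - f) huf).exists_seq_tendsto_ae
    have hle : ∀ n, ∀ᵐ y ∂ν, ‖‖S' f y‖ - ‖S f y‖‖ₑ - ‖S' (u n - f) y‖ₑ ≤
        ‖‖T (u n) y‖ - ‖S f y‖‖ₑ := by
      intro n
      have h := hS'.enorm_norm_sub_norm_le (hut' n) hf (hsub (hut' n) hf) (hsub hf (hut' n))
      rw [hS'T _ (hu n) (hut' n)] at h
      filter_upwards [h] with y hy
      rw [tsub_le_iff_left]
      have h2 := enorm_add_le (‖S' f y‖ - ‖T (u n) y‖) (‖T (u n) y‖ - ‖S f y‖)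
      rw [sub_add_sub_cancel, enorm_norm_sub_norm_comm] at h2
      refine (le_of_eq_of_le ?_ h2).trans (add_le_add_left ?_ _)
      · rw [enorm_norm_sub_norm_comm]
      · rwa [enorm_norm_sub_norm_comm]
    -- Nothing is known about integrals of `S' (u n - f)`, only a.e. convergence to 0 along a
    -- subsequence. It is therefore removed by truncated subtraction inside the integral, and
    -- Fatou's lemma gives the limit.
    have h0 : ∫⁻ y, ‖‖S' f y‖ - ‖S f y‖‖ₑ ∂ν = 0 := by
      refine le_antisymm ?_ (zero_le)
      calc ∫⁻ y, ‖‖S' f y‖ - ‖S f y‖‖ₑ ∂ν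
          = ∫⁻ y, liminf (fun k =>
              ‖‖S' f y‖ - ‖S f y‖‖ₑ - ‖S' (u (ns k) - f) y‖ₑ) atTop ∂ν := by
            refine lintegral_congr_ae ?_
            filter_upwards [hae] with y hy
            have h2 : Tendsto (fun k => ‖S' (u (ns k) - f) y‖ₑ) atTop (𝓝 0) := by
              simpa using hy.enorm
            have h3 := ENNReal.Tendsto.sub (tendsto_const_nhds
              (x := ‖‖S' f y‖ - ‖S f y‖‖ₑ)) h2 (.inl enorm_ne_top)
            rw [tsub_zero] at h3
            exact h3.liminf_eq.symm
        _ ≤ liminf (fun k => ∫⁻ y,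
              (‖‖S' f y‖ - ‖S f y‖‖ₑ - ‖S' (u (ns k) - f) y‖ₑ) ∂ν) atTop :=
            lintegral_liminf_le' fun k => (aemeasurable_enorm_norm_sub_norm _ _).sub
              (S' (u (ns k) - f)).aestronglyMeasurable.enorm
        _ ≤ liminf (fun k => ∫⁻ y, ‖‖T (u (ns k)) y‖ - ‖S f y‖‖ₑ ∂ν) atTop :=
            liminf_le_liminf (.of_forall fun k => lintegral_mono_ae (hle (ns k)))
        _ = 0 := (h1.comp hns.tendsto_atTop).liminf_eq
    rw [lintegral_eq_zero_iff' (aemeasurable_enorm_norm_sub_norm _ _)] at h0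
    filter_upwards [h0] with y hy
    rw [Pi.zero_apply, enorm_eq_zero, sub_eq_zero] at hy
    exact hy

end Extension

/-! ### Layer estimates and the bound on the original domain -/

section Bounds

variable {α β 𝕜 : Type*} [MeasurableSpace α] [MeasurableSpace β] [RCLike 𝕜]
  {μ : Measure α} {ν : Measure β} {φ : ℝ → ℝ} {p₀ p₁ P C : ℝ} {V : ℝ≥0}
  {T : (α →ₘ[μ] 𝕜) → (β →ₘ[ν] 𝕜)}

/-- Otherwise the rearrangement is at least `a` everywhere, while the weight has infinite total
mass. The minimum with 1 covers `a = ∞`. -/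
lemma distribution_ne_top (hφ : Admissible φ) (hp₀ : 1 < p₀) {f : α →ₘ[μ] 𝕜}
    (hf : weightedNorm (logWeight φ p₀) f ≠ ∞) {a : ℝ≥0∞} (ha : a ≠ 0) :
    distribution f a ≠ ∞ := by
  intro h
  have hle : ∀ s : ℝ, 0 ≤ s → ENNReal.ofReal (p₀ * s ^ (1 / p₀)) * min a 1 ≤
      weightedNorm (logWeight φ p₀) f := by
    intro s hs
    rw [← setLIntegral_powWeight (by linarith) hs, ← lintegral_mul_const' _ _ (by simp)]
    refine le_trans (lintegral_mono fun t => mul_le_mul' (powWeight_le_logWeight hφ p₀ t)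
      ((min_le_left a 1).trans (le_rearrangement_of_lt (f := f) (t := t)
        (h ▸ ENNReal.ofReal_lt_top))))
      (lintegral_mono_set Set.Ioc_subset_Ioi_self)
  have ha' : min a 1 ≠ 0 := (lt_min (pos_iff_ne_zero.2 ha) one_pos).ne'
  set M := weightedNorm (logWeight φ p₀) f / min a 1 with hM
  have hMt : M ≠ ∞ := ENNReal.div_ne_top hf ha'
  -- This endpoint turns the mass bound into `p₀ * (M + 1) ≤ M`, which is absurd.
  have h1 := hle ((M.toReal + 1) ^ p₀) (by positivity)
  rw [← ENNReal.le_div_iff_mul_le (.inl ha') (.inl (by simp)), ← hM,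
    ← Real.rpow_mul (by positivity), mul_one_div_cancel (by linarith), Real.rpow_one,
    ENNReal.ofReal_le_iff_le_toReal hMt] at h1
  have h2 : 0 ≤ M.toReal := ENNReal.toReal_nonneg
  nlinarith

/-- The estimate for one layer of `f`, by the hypothesis at the exponent adapted to the measure
of its support. -/
lemma weakNorm_cut_le (hφ : Admissible φ) {b : ℝ}
    (hb : ∀ c x : ℝ, 1 ≤ c → 1 ≤ x → φ (c * x) ≤ c ^ b * φ x)
    (hp₀ : 1 < p₀) (hp₀P : p₀ ≤ P) (hP : P < p₁) (hC : 0 ≤ C) (hV : ν Set.univ ≤ V)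
    (hT : ∀ p : ℝ, p₀ < p → p ≤ p₁ → ∀ f ∈ LorentzOne 𝕜 μ p, weakNorm p (T f) ≤
      ENNReal.ofReal (C * φ ((1 / p₀ - 1 / p)⁻¹)) * lorentzOneNorm p f)
    {f : α →ₘ[μ] 𝕜} {y z : ℝ≥0∞} (hfy : distribution f y ≠ ∞) (hz : z ≠ ∞) :
    weakNorm p₀ (T (cut y z f)) ≤
      ENNReal.ofReal (max (V : ℝ) 1 * (p₁ * Real.exp 1 * (1 / P - 1 / p₁)⁻¹ ^ b) * C) * (z *
        ∫⁻ t in Set.Ioc 0 (distribution f y).toReal, logWeight φ p₀ t) := by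
  have hP0 : 0 < P := by linarith
  have hδ : 0 < 1 / P - 1 / p₁ := sub_pos.2 (one_div_lt_one_div_of_lt hP0 hP)
  have hp1 : 0 < p₁ := by linarith
  obtain ⟨p, hp, hp', hφp, hle⟩ := hφ.exists_exponent hb hp₀ hp₀P hP
    (ENNReal.toReal_nonneg (a := distribution f y))
  have hnorm := lorentzOneNorm_cut_le (p := p) (by linarith) hfy hz
  have hmem : cut y z f ∈ LorentzOne 𝕜 μ p :=
    hnorm.trans_lt (ENNReal.mul_lt_top ENNReal.ofReal_lt_top hz.lt_top)
  have hlow := le_setLIntegral_logWeight hφ hp₀ (ENNReal.toReal_nonneg (a := distribution f y))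
  set s := (distribution f y).toReal
  set K := p₁ * Real.exp 1 * (1 / P - 1 / p₁)⁻¹ ^ b
  have hK : 0 ≤ K := by positivity
  have hM : (0 : ℝ) ≤ max (V : ℝ) 1 := by positivity
  calc weakNorm p₀ (T (cut y z f))
      ≤ ENNReal.ofReal (max (V : ℝ) 1) * weakNorm p (T (cut y z f)) :=
        weakNorm_le_mul_weakNorm hV hp₀ hp.le _
    _ ≤ ENNReal.ofReal (max (V : ℝ) 1) * (ENNReal.ofReal (C * φ ((1 / p₀ - 1 / p)⁻¹)) *
          (ENNReal.ofReal (p * s ^ (1 / p)) * z)) :=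
        mul_le_mul_right ((hT p hp hp' _ hmem).trans (mul_le_mul_right hnorm _)) _
    _ = ENNReal.ofReal (max (V : ℝ) 1 * C * (φ ((1 / p₀ - 1 / p)⁻¹) * (p * s ^ (1 / p)))) * z := by
        rw [← mul_assoc, ← mul_assoc, ← ENNReal.ofReal_mul hM,
          ← ENNReal.ofReal_mul (by positivity)]
        congr 2
        ring
    _ ≤ ENNReal.ofReal (max (V : ℝ) 1 * C * (K * (s ^ (1 / p₀) * φ (1 + Real.posLog (1 / s))))) *
          z := by gcongr
    _ = ENNReal.ofReal (max (V : ℝ) 1 * K * C) * (z *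
          ENNReal.ofReal (s ^ (1 / p₀) * φ (1 + Real.posLog (1 / s)))) := by
        rw [mul_comm z, ← mul_assoc (ENNReal.ofReal (max (V : ℝ) 1 * K * C)),
          ← ENNReal.ofReal_mul (by positivity)]
        congr 2
        ring
    _ ≤ _ := mul_le_mul_right (mul_le_mul_right hlow _) _

lemma setLIntegral_le_sum_layers {D : Submodule 𝕜 (α →ₘ[μ] 𝕜)}
    (hT : SublinearOn (D : Set (α →ₘ[μ] 𝕜)) T) {f : α →ₘ[μ] 𝕜}
    (hD : ∀ a b : ℝ≥0∞, b ≠ ∞ → cut a b f ∈ D) {c : ℝ≥0∞} (hc : c ≠ ∞) (E : Set β) (n : ℕ) :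
    ∫⁻ y in E, ‖T (cut 0 (2 ^ n * c) f) y‖ₑ ∂ν ≤ ∫⁻ y in E, ‖T (cut 0 c f) y‖ₑ ∂ν +
      ∑ k ∈ Finset.range n,
        ∫⁻ y in E, ‖T (cut (2 ^ k * c) (2 ^ (k + 1) * c) f) y‖ₑ ∂ν := by
  have hfin : ∀ k : ℕ, 2 ^ k * c ≠ ∞ := fun k => ENNReal.mul_ne_top (by simp) hc
  induction n with
  | zero => simp
  | succ n ih =>
    have hle : 2 ^ n * c ≤ 2 ^ (n + 1) * c := by
      gcongr
      · exact one_le_two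
      · exact n.le_succ
    rw [Finset.sum_range_succ, ← add_assoc, ← cut_add_cut zero_le hle f]
    exact (hT.setLIntegral_add_le (hD _ _ (hfin n)) (hD _ _ (hfin (n + 1))) E).trans
      (add_le_add_left ih _)

lemma lorentzOne_subset_lorentzSpan {p : ℝ} (hp : p ∈ Set.Ioc p₀ p₁) {f : α →ₘ[μ] 𝕜}
    (hf : f ∈ LorentzOne 𝕜 μ p) : f ∈ lorentzSpan 𝕜 μ p₀ p₁ :=
  Submodule.subset_span (Set.mem_iUnion₂.2 ⟨p, hp, hf⟩)

lemma tendsto_setLIntegral_of_tendsto_lorentzOneNorm [IsFiniteMeasure ν] (hp₀ : 1 < p₀)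
    (hV : ν Set.univ ≤ V)
    (hT : ∀ p : ℝ, p₀ < p → p ≤ p₁ → ∀ f ∈ LorentzOne 𝕜 μ p, weakNorm p (T f) ≤
      ENNReal.ofReal (C * φ ((1 / p₀ - 1 / p)⁻¹)) * lorentzOneNorm p f)
    {p : ℝ} (hp : p₀ < p) (hp' : p ≤ p₁) {u : ℕ → (α →ₘ[μ] 𝕜)}
    (hu : Tendsto (fun n => lorentzOneNorm p (u n)) atTop (𝓝 0)) (E : Set β) :
    Tendsto (fun n => ∫⁻ y in E, ‖T (u n) y‖ₑ ∂ν) atTop (𝓝 0) := by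
  set A := ENNReal.ofReal (p₀ / (p₀ - 1)) *
    (ENNReal.ofReal (max (V : ℝ) 1) * ENNReal.ofReal (C * φ ((1 / p₀ - 1 / p)⁻¹))) *
      ν E ^ (1 - 1 / p₀) with hA
  have hp₀' : 0 ≤ 1 - 1 / p₀ := by
    rw [sub_nonneg, div_le_one (by linarith)]
    exact hp₀.le
  have hAt : A ≠ ∞ := ENNReal.mul_ne_top (ENNReal.mul_ne_top ENNReal.ofReal_ne_top
    (ENNReal.mul_ne_top ENNReal.ofReal_ne_top ENNReal.ofReal_ne_top))
    (ENNReal.rpow_ne_top_of_nonneg hp₀' (measure_ne_top ν E))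
  have h := ENNReal.Tendsto.const_mul hu (.inr hAt)
  rw [mul_zero] at h
  refine tendsto_of_tendsto_of_tendsto_of_le_of_le' tendsto_const_nhds h
    (.of_forall fun _ => zero_le) ?_
  filter_upwards [hu.eventually (gt_mem_nhds ENNReal.zero_lt_top)] with n hn
  refine (setLIntegral_enorm_le_of_weakNorm_le hp₀ ((weakNorm_le_mul_weakNorm hV hp₀ hp.le
    (T (u n))).trans (mul_le_mul_right (hT p hp hp' _ hn) _)) E).trans (le_of_eq ?_)
  rw [hA]
  ring

/-- The bound for `T` on the part of its domain that lies in `L^{p₀,1} φ(log L)`, in terms of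
the integrals over sets. -/
lemma setLIntegral_enorm_le_of_mem_lorentzSpan (hφ : Admissible φ) {b : ℝ}
    (hb : ∀ c x : ℝ, 1 ≤ c → 1 ≤ x → φ (c * x) ≤ c ^ b * φ x)
    (hp₀ : 1 < p₀) (hp₀P : p₀ ≤ P) (hP : P < p₁) (hC : 0 ≤ C) (hV : ν Set.univ ≤ V)
    (hTs : SublinearOn (lorentzSpan 𝕜 μ p₀ p₁ : Set (α →ₘ[μ] 𝕜)) T)
    (hT : ∀ p : ℝ, p₀ < p → p ≤ p₁ → ∀ f ∈ LorentzOne 𝕜 μ p, weakNorm p (T f) ≤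
      ENNReal.ofReal (C * φ ((1 / p₀ - 1 / p)⁻¹)) * lorentzOneNorm p f)
    {f : α →ₘ[μ] 𝕜} (hf : weightedNorm (logWeight φ p₀) f ≠ ∞)
    (hfD : f ∈ lorentzSpan 𝕜 μ p₀ p₁) (E : Set β) :
    ∫⁻ y in E, ‖T f y‖ₑ ∂ν ≤ ENNReal.ofReal (p₀ / (p₀ - 1)) *
      (ENNReal.ofReal (max (V : ℝ) 1 * (p₁ * Real.exp 1 * (1 / P - 1 / p₁)⁻¹ ^ b) * C) *
        (4 * weightedNorm (logWeight φ p₀) f)) * ν E ^ (1 - 1 / p₀) := by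
  have : IsFiniteMeasure ν := ⟨hV.trans_lt ENNReal.coe_lt_top⟩
  have hw := logWeight_antitoneOn hφ hp₀
  have hp₀₁ : p₀ < p₁ := hp₀P.trans_lt hP
  set M := ENNReal.ofReal (max (V : ℝ) 1 * (p₁ * Real.exp 1 * (1 / P - 1 / p₁)⁻¹ ^ b) * C)
  set R := ENNReal.ofReal (p₀ / (p₀ - 1))
  set N := weightedNorm (logWeight φ p₀) f
  have hD : ∀ y z : ℝ≥0∞, z ≠ ∞ → cut y z f ∈ lorentzSpan 𝕜 μ p₀ p₁ := fun y z hz =>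
    lorentzOne_subset_lorentzSpan ⟨hp₀₁, le_rfl⟩ (cut_mem_lorentzOne hφ hp₀ hp₀₁.le hf y hz)
  obtain ⟨q, hq, hfq⟩ := exists_localWeight_ne_top_of_mem_lorentzSpan hp₀ hp₀₁ hfD
  have hc0 : ∀ n : ℕ, ((2 : ℝ≥0∞) ^ n)⁻¹ ≠ 0 := fun n => by simp
  have hct : ∀ n : ℕ, ((2 : ℝ≥0∞) ^ n)⁻¹ ≠ ∞ := fun n => by simp
  have htop : Tendsto (fun n : ℕ => (2 : ℝ≥0∞) ^ n) atTop (𝓝 ∞) :=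
    ENNReal.tendsto_pow_atTop_nhds_top_iff.2 ENNReal.one_lt_two
  have hbot : Tendsto (fun n : ℕ => ((2 : ℝ≥0∞) ^ n)⁻¹) atTop (𝓝 0) := by
    simpa using htop.inv
  have h1 := tendsto_setLIntegral_of_tendsto_lorentzOneNorm hp₀ hV hT hp₀₁ le_rfl
    (tendsto_lorentzOneNorm_cut_zero hφ hp₀ hp₀₁.le hf hbot) E
  have h2 := tendsto_setLIntegral_of_tendsto_lorentzOneNorm hp₀ hV hT hq.1 hq.2
    (tendsto_lorentzOneNorm_cut_top hw (fun t ht => logWeight_ne_zero hφ p₀ ht)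
      (hp₀.trans hq.1) hf hfq htop) E
  have h3 := (h1.add h2).const_add (R * (M * (4 * N)) * ν E ^ (1 - 1 / p₀))
  rw [add_zero, add_zero] at h3
  refine ge_of_tendsto' h3 fun n => ?_
  have hlev : (2 : ℝ≥0∞) ^ (2 * n) * (2 ^ n)⁻¹ = 2 ^ n := by
    rw [two_mul, pow_add, mul_assoc, ENNReal.mul_inv_cancel (by simp) (by simp), mul_one]
  have hsplit : cut 0 (2 ^ n) f + cut (2 ^ n) ∞ f = f := by
    rw [cut_add_cut zero_le le_top, cut_zero_top]
  -- The unbounded part is in the domain only as the difference of `f` and a bounded truncation;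
  -- this needs `f` in the span.
  have hDt : cut (2 ^ n) ∞ f ∈ lorentzSpan 𝕜 μ p₀ p₁ := by
    rw [eq_sub_of_add_eq' hsplit]
    exact Submodule.sub_mem _ hfD (hD _ _ (by simp))
  have hlayers := setLIntegral_le_sum_layers hTs hD (hct n) E (2 * n)
  rw [hlev] at hlayers
  have hsum : ∑ k ∈ Finset.range (2 * n), ∫⁻ y in E,
      ‖T (cut (2 ^ k * (2 ^ n)⁻¹) (2 ^ (k + 1) * (2 ^ n)⁻¹) f) y‖ₑ ∂ν ≤
        R * (M * (4 * N)) * ν E ^ (1 - 1 / p₀) := by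
    calc _ ≤ ∑ k ∈ Finset.range (2 * n), R * (M * (2 ^ (k + 1) * (2 ^ n)⁻¹ *
            ∫⁻ t in Set.Ioc 0 (distribution f (2 ^ k * (2 ^ n)⁻¹)).toReal,
              logWeight φ p₀ t)) * ν E ^ (1 - 1 / p₀) := by
          refine Finset.sum_le_sum fun k _ => setLIntegral_enorm_le_of_weakNorm_le hp₀ ?_ E
          exact weakNorm_cut_le hφ hb hp₀ hp₀P hP hC hV hT
            (distribution_ne_top hφ hp₀ hf (mul_ne_zero (by simp) (hc0 n)))
            (ENNReal.mul_ne_top (by simp) (hct n))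
      _ = R * (M * (2 * ∑ k ∈ Finset.range (2 * n), 2 ^ k * (2 ^ n)⁻¹ *
            ∫⁻ t in Set.Ioc 0 (distribution f (2 ^ k * (2 ^ n)⁻¹)).toReal,
              logWeight φ p₀ t)) * ν E ^ (1 - 1 / p₀) := by
          rw [Finset.mul_sum, Finset.mul_sum, Finset.mul_sum, Finset.sum_mul]
          refine Finset.sum_congr rfl fun k _ => ?_
          ring
      -- One factor 2 comes from bounding a layer by its upper level `2 ^ (k + 1)`, the other from
      -- the dyadic sum.
      _ ≤ R * (M * (2 * (2 * N))) * ν E ^ (1 - 1 / p₀) := by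
          gcongr
          exact sum_dyadic_setLIntegral_le hw f _ _
      _ = _ := by ring
  calc ∫⁻ y in E, ‖T f y‖ₑ ∂ν
      ≤ ∫⁻ y in E, ‖T (cut 0 (2 ^ n) f) y‖ₑ ∂ν + ∫⁻ y in E, ‖T (cut (2 ^ n) ∞ f) y‖ₑ ∂ν := by
        conv_lhs => rw [← hsplit]
        exact hTs.setLIntegral_add_le (hD _ _ (by simp)) hDt E
    _ ≤ (∫⁻ y in E, ‖T (cut 0 (2 ^ n)⁻¹ f) y‖ₑ ∂ν + R * (M * (4 * N)) * ν E ^ (1 - 1 / p₀)) +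
          ∫⁻ y in E, ‖T (cut (2 ^ n) ∞ f) y‖ₑ ∂ν :=
        add_le_add_left (hlayers.trans (add_le_add_right hsum _)) _
    _ = _ := by ring

end Bounds

end Extrapolation

/-! ### The extrapolation theorem -/

theorem mainTheorem2 (𝕜 : Type*) [RCLike 𝕜]
    (φ : ℝ → ℝ) (hφ : Extrapolation.Admissible φ)
    (p₁ P : ℝ) (hP : 1 < P) (hPp₁ : P < p₁) (V : ℝ≥0) :
    -- the implied constant: uniform in the operator, the measure spaces, `C` and `1 < p₀ ≤ P`
    ∃ K : ℝ, 0 < K ∧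
      ∀ (α : Type*) (β : Type*) [MeasurableSpace α] [MeasurableSpace β]
        (μ : Measure α) (ν : Measure β), ν Set.univ ≤ V →
      ∀ p₀ : ℝ, 1 < p₀ → p₀ ≤ P →
      ∀ (C : ℝ), 0 ≤ C →
      ∀ T : (α →ₘ[μ] 𝕜) → (β →ₘ[ν] 𝕜),
        Extrapolation.SublinearOn (Extrapolation.lorentzSpan 𝕜 μ p₀ p₁ : Set (α →ₘ[μ] 𝕜)) T →
        (∀ p : ℝ, p₀ < p → p ≤ p₁ → ∀ f ∈ Extrapolation.LorentzOne 𝕜 μ p,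
          Extrapolation.weakNorm p (T f) ≤
            ENNReal.ofReal (C * φ ((1 / p₀ - 1 / p)⁻¹)) * Extrapolation.lorentzOneNorm p f) →
      -- the operator `T` itself obeys the bound wherever it is defined
      (∀ f ∈ Extrapolation.LorentzLog 𝕜 μ φ p₀, f ∈ Extrapolation.lorentzSpan 𝕜 μ p₀ p₁ →
        Extrapolation.weakNorm p₀ (T f) ≤
          ENNReal.ofReal (K * (C / (p₀ - 1))) * Extrapolation.lorentzLogNorm φ p₀ f) ∧
      -- and it extends, uniquely up to the modulus, to the whole space with the same bound
      ∃ S : (α →ₘ[μ] 𝕜) → (β →ₘ[ν] 𝕜),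
        Extrapolation.SublinearOn (Extrapolation.LorentzLog 𝕜 μ φ p₀) S ∧
        (∀ f ∈ Extrapolation.LorentzLog 𝕜 μ φ p₀,
          f ∈ Extrapolation.lorentzSpan 𝕜 μ p₀ p₁ → S f = T f) ∧
        (∀ f ∈ Extrapolation.LorentzLog 𝕜 μ φ p₀,
          Extrapolation.weakNorm p₀ (S f) ≤
            ENNReal.ofReal (K * (C / (p₀ - 1))) * Extrapolation.lorentzLogNorm φ p₀ f) ∧
        ∀ S' : (α →ₘ[μ] 𝕜) → (β →ₘ[ν] 𝕜),
          Extrapolation.SublinearOn (Extrapolation.LorentzLog 𝕜 μ φ p₀) S' →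
          (∀ f ∈ Extrapolation.LorentzLog 𝕜 μ φ p₀,
            f ∈ Extrapolation.lorentzSpan 𝕜 μ p₀ p₁ → S' f = T f) →
          Extrapolation.NullContinuous φ p₀ S' →
          ∀ f ∈ Extrapolation.LorentzLog 𝕜 μ φ p₀, ∀ᵐ y ∂ν, ‖S' f y‖ = ‖S f y‖ := by
  obtain ⟨b, -, hb⟩ := hφ.exists_growth
  have hP0 : 0 < P := by linarith
  have hp1 : 0 < p₁ := by linarith
  have hδ : 0 < 1 / P - 1 / p₁ := sub_pos.2 (one_div_lt_one_div_of_lt hP0 hPp₁)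
  set K₀ : ℝ := max (V : ℝ) 1 * (p₁ * Real.exp 1 * (1 / P - 1 / p₁)⁻¹ ^ b) with hK₀
  have hK₀pos : 0 < K₀ := by positivity
  -- The 4 is the layer-sum constant, and `P` bounds the numerator of `p₀ / (p₀ - 1)`.
  refine ⟨4 * P * K₀, by positivity, ?_⟩
  intro α β _ _ μ ν hV p₀ hp₀ hp₀P C hC T hTs hT
  have hfin : IsFiniteMeasure ν := ⟨hV.trans_lt ENNReal.coe_lt_top⟩
  have hp₀₁ : p₀ < p₁ := hp₀P.trans_lt hPp₁
  have hp₀1 : 0 < p₀ - 1 := by linarith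
  have hexp : 0 ≤ 1 - 1 / p₀ := by
    rw [sub_nonneg, div_le_one (by linarith)]
    exact hp₀.le
  have hw := Extrapolation.logWeight_antitoneOn hφ hp₀
  have hset : Extrapolation.LorentzLog 𝕜 μ φ p₀ =
      {f | Extrapolation.weightedNorm (Extrapolation.logWeight φ p₀) f ≠ ∞} := by
    ext f
    rw [Set.mem_ofPred_eq, ← lt_top_iff_ne_top, ← Extrapolation.lorentzLogNorm_eq]
    rfl
  set B : ℝ≥0∞ := ENNReal.ofReal (4 * P * K₀ * (C / (p₀ - 1))) with hB
  have hbound : ∀ f ∈ Extrapolation.lorentzSpan 𝕜 μ p₀ p₁,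
      Extrapolation.weightedNorm (Extrapolation.logWeight φ p₀) f ≠ ∞ → ∀ E : Set β,
      ∫⁻ y in E, ‖T f y‖ₑ ∂ν ≤ B * ν E ^ (1 - 1 / p₀) *
        Extrapolation.weightedNorm (Extrapolation.logWeight φ p₀) f := by
    intro f hfD hf E
    refine (Extrapolation.setLIntegral_enorm_le_of_mem_lorentzSpan hφ hb hp₀ hp₀P hPp₁ hC hV
      hTs hT hf hfD E).trans ?_
    rw [← hK₀, mul_right_comm B]
    refine mul_le_mul_left ?_ _
    have h4 : (4 : ℝ≥0∞) = ENNReal.ofReal 4 := by simp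
    rw [← mul_assoc, ← mul_assoc, h4, ← ENNReal.ofReal_mul (by positivity),
      ← ENNReal.ofReal_mul (by positivity)]
    refine mul_le_mul_left (ENNReal.ofReal_le_ofReal ?_) _
    calc p₀ / (p₀ - 1) * (K₀ * C) * 4 = 4 * p₀ * K₀ * (C / (p₀ - 1)) := by ring
      _ ≤ 4 * P * K₀ * (C / (p₀ - 1)) := by gcongr
  have hweak : ∀ {h : β →ₘ[ν] 𝕜} {N : ℝ≥0∞},
      (∀ E : Set β, ∫⁻ y in E, ‖h y‖ₑ ∂ν ≤ B * ν E ^ (1 - 1 / p₀) * N) →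
        Extrapolation.weakNorm p₀ h ≤ B * N := fun hN =>
    Extrapolation.weakNorm_le_of_setLIntegral_le (by linarith) fun E _ =>
      (hN E).trans_eq (mul_right_comm _ _ _)
  obtain ⟨S, hS, hST, hSB, hSu⟩ := Extrapolation.exists_sublinear_extension hw hTs
    (A := B * ν Set.univ ^ (1 - 1 / p₀))
    (ENNReal.mul_ne_top ENNReal.ofReal_ne_top
      (ENNReal.rpow_ne_top_of_nonneg hexp (measure_ne_top ν _)))
    (fun f hfD hf => by simpa using hbound f hfD hf Set.univ)
    (fun f hf => by
      -- The approximants are bounded truncations, which lie in `L^{p₁,1}`; the error is, up to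
      -- sign, the part of `f` above level `n`.
      refine ⟨fun n : ℕ => Extrapolation.cut 0 n f, fun n =>
        Extrapolation.lorentzOne_subset_lorentzSpan ⟨hp₀₁, le_rfl⟩
          (Extrapolation.cut_mem_lorentzOne hφ hp₀ hp₀₁.le hf 0 (ENNReal.natCast_ne_top n)),
        fun n => Extrapolation.weightedNorm_mono _ (Extrapolation.enorm_cut_le _ _ f), ?_⟩
      refine (Extrapolation.tendsto_weightedNorm_cut_top hw
        (fun t _ => Extrapolation.logWeight_ne_top φ p₀ t)
        (fun t ht => Extrapolation.logWeight_ne_zero hφ p₀ ht) hf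
        ENNReal.tendsto_nat_nhds_top).congr fun n => ?_
      have h := Extrapolation.cut_add_cut (zero_le (a := (n : ℝ≥0∞))) le_top f
      rw [Extrapolation.cut_zero_top] at h
      rw [← Extrapolation.weightedNorm_neg, ← sub_eq_of_eq_add' h.symm, neg_sub])
  simp only [Extrapolation.NullContinuous, Extrapolation.lorentzLogNorm_eq, hset]
  exact ⟨fun f hf hfD => hweak (hbound f hfD hf), S, hS, fun f hf hfD => hST f hfD hf,
    fun f hf => hweak fun E => hSB E _ (fun g hg hg' => hbound g hg hg' E) f hf,
    fun S' hS' hS'T hS'0 => hSu S' hS' (fun f hfD hf => hS'T f hf hfD) hS'0⟩
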